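/- For $n\ge 2$ let $E_n=\binom{[n]}{2}$ and $N=\binom n2$. For positive coefficients $\alpha=(\alpha_e)_{e\in E_n}$ let $X$ be uniformly distributed (with respect to Lebesgue measure) on the simplex $$\Sigma=\Big\{x\in\mathbb R_{+}^{E_n}:\ \sum_{e\in E_n}\alpha_e x_e\le N\Big\},$$ and let $G_{\Sigma,p}$ be the random graph with vertex set $[n]$ and edge set $\{e\in E_n: X_e\le p\}$. (a) Let $\alpha_e=1$ for all $e$, and let $p=\frac{\ln n+c_n}{n}$ with $c_n\in\mathbb R$. Then $$\lim_{n\to\infty}\mathbf P(G_{\Sigma,p}\text{ is connected})=\begin{cases}0&\text{if }c_n\to-\infty,\\ e^{-e^{-c}}&\text{if }c_n\to c\in\mathbb R,\\ 1&\text{if }c_n\to\infty.\end{cases}$$ (b) Let $\alpha=\alpha^{(n)}$ and $M=M(n)>0$ be such that, for all sufficiently large $n$, $\frac1M\le\alpha_e\le M$ for every $e\in E_n$, and $M\le(\ln n)^{1/4}$. Put $\alpha_v=\sum_{w\ne v}\alpha_{vw}$ for $v\in[n]$. Then, for all sufficiently large $n$, the equation $$\sum_{v\in[n]}\Big(1-\frac{\alpha_v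 p}{N}\Big)^N=1$$ has exactly one solution $p=p_0(n)$ in the range $0\le p\le N/\max_v\alpha_v$, and for every fixed $\varepsilon>0$ and every real sequence $p=p(n)$, $$\lim_{n\to\infty}\mathbf P(G_{\Sigma,p}\text{ is connected})=\begin{cases}0&\text{if }p\le(1-\varepsilon)p_0\text{ for all large }n,\\ 1&\text{if }p\ge(1+\varepsilon)p_0\text{ for all large }n.\end{cases}$$ -/

import Mathlib

open Filter Topology MeasureTheory

namespace SimplexGraph

/-- The unordered pairs of distinct elements of `[n]`, i.e. the edges of the complete graph. -/
abbrev Edge (n : ℕ) : Type := {e : Sym2 (Fin n) // ¬ e.IsDiag}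

/-- The simplex of nonnegative vectors `x` indexed by the edges with `∑ e, α e * x e ≤ L`. -/
def simplex (n : ℕ) (L : ℝ) (α : Edge n → ℝ) : Set (Edge n → ℝ) :=
  {x | (∀ e, 0 ≤ x e) ∧ ∑ e, α e * x e ≤ L}

/-- The uniform distribution on the simplex with `L = N = n.choose 2`: Lebesgue measure
conditioned on (restricted to, and normalized on) the simplex. -/
noncomputable def law (n : ℕ) (α : Edge n → ℝ) : Measure (Edge n → ℝ) :=
  ProbabilityTheory.cond volume (simplex n (n.choose 2 : ℝ) α)

/-- The graph on `[n]` whose edges are the pairs `e` with `x e ≤ p`. -/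
def thresholdGraph {n : ℕ} (x : Edge n → ℝ) (p : ℝ) : SimpleGraph (Fin n) where
  Adj v w := ∃ h : ¬ (s(v, w) : Sym2 (Fin n)).IsDiag, x ⟨s(v, w), h⟩ ≤ p
  symm := ⟨fun v w => by
    rintro ⟨h, hx⟩
    have hs : (s(v, w) : Sym2 (Fin n)) = s(w, v) := Sym2.eq_swap
    refine ⟨hs ▸ h, ?_⟩
    have he : (⟨s(w, v), hs ▸ h⟩ : Edge n) = ⟨s(v, w), h⟩ := Subtype.ext hs.symm
    rw [he]
    exact hx⟩
  loopless := ⟨fun v => by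
    rintro ⟨h, -⟩
    exact h rfl⟩

/-- The probability that the random graph is connected. -/
noncomputable def probConnected (n : ℕ) (α : Edge n → ℝ) (p : ℝ) : ℝ :=
  (law n α).real {x | (thresholdGraph x p).Connected}

/-- `α` is `M`-bounded. -/
def MBounded {n : ℕ} (M : ℝ) (α : Edge n → ℝ) : Prop :=
  ∀ e, 1 / M ≤ α e ∧ α e ≤ M

/-- `α_v`, the sum of `α e` over the edges `e = vw`, `w ≠ v`, at the vertex `v`. -/
noncomputable def vertexWeight {n : ℕ} (α : Edge n → ℝ) (v : Fin n) : ℝ :=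
  ∑ e ∈ (Finset.univ : Finset (Edge n)).filter (fun e => v ∈ e.1), α e

/-- `ξ_v(p) = (1 - α_v p / N) ^ N`. -/
noncomputable def xi {n : ℕ} (α : Edge n → ℝ) (p : ℝ) (v : Fin n) : ℝ :=
  (1 - vertexWeight α v * p / (n.choose 2 : ℝ)) ^ n.choose 2

/-- `p` is a solution of `∑ v, ξ_v(p) = 1` in the range `p ≥ 0`, `α_v p ≤ N` for all `v`,
on which `ξ_v(p)` is the probability that the vertex `v` is isolated. (For larger `p` the
polynomial has no probabilistic meaning, and for even `N` the equation has
spurious roots there.) -/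
def IsCritical {n : ℕ} (α : Edge n → ℝ) (p : ℝ) : Prop :=
  0 ≤ p ∧ (∀ v, vertexWeight α v * p ≤ (n.choose 2 : ℝ)) ∧ ∑ v, xi α p v = 1

end SimplexGraph

/-!
The whole proof rests on one exact formula. Cutting a corner off the simplex leaves a translate of
a smaller copy of it, so for `0 ≤ p` the probability that all edges of a set `B` are absent is
`(1 - α(B) p / N)₊ ^ N`, where `α(B) = ∑ e ∈ B, α e` (`law_real_lt`, `prob_superset`). Although the
edges are dependent, this is at most `exp (-α(B) p)`, as for independent edges, and for the sets
`B` that matter it is also close to that bound. Since events only depend on the finite set of absent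
edges, all expectations are finite sums (`expect`, `prob_eq_expect`).

**Connectivity.** A disconnected graph has a set `S` of at most half of the vertices whose cut is
absent. A union bound over `S` treats two ranges. For `|S| ≤ K`, with `K` of order `n / log n`,
the cut of `S` weighs `∑ v ∈ S, α_v` up to `|S| ^ 2 * max α`, so that the sum over `S` is compared
with the product `∏ v, (1 + θ exp (-α_v p))` (`sum_small_cut_le`). For `|S| > K` the weight of
the cut times `p` is at least `τ |S|` with `τ` of order `√(log n)`, which beats the number of such
sets because `log (n / K)` is only of order `log (log n)` (`sum_large_cut_le`,
`tendsto_large_cut_bound`).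

**Equal coefficients.** At `p = (log n + c) / n` with `c` constant, the binomial moments of the
number of isolated vertices converge to `exp (-c) ^ r / r!`, and Bonferroni's inequalities give
the limit `exp (-exp (-c))` for the probability that there is none (`tendsto_prob_no_isolated`).
A component that is not a single vertex contains an edge, which costs one more factor of order `p`;
with it the union bound over small cuts tends to zero
(`tendsto_prob_not_connected_no_isolated`). Monotonicity in `p` reduces every sequence
`c n` to constants.

**Bounded coefficients.** The function `p ↦ ∑ v, ξ_v(p)` decreases strictly from `n` to at most `1`,
which gives `p₀`. Comparing it with its extreme terms shows that `p₀` lies between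
`log n / (2 (n - 1) M)` and `M log n / (n - 1)`, and that every `α_v p₀` is at least
`√(log n) / 2`; this is where `M ≤ (log n) ^ (1/4)` enters. Passing from `p₀` to `(1 ± ε) p₀`
therefore changes the expected number of isolated vertices, which is `1` at `p₀`, by a factor of
at least `exp (ε √(log n) / 2)`, up to constants. Below `p₀` the second moment method applies
because two vertices are isolated nearly independently (`prob_no_isolated_le`,
`prob_star_union_le`); above `p₀` the union bound over cuts applies.
-/

namespace SimplexGraph

/-! ### Tail probabilities of a uniform point of the simplex -/

lemma card_edge (n : ℕ) : Fintype.card (Edge n) = n.choose 2 := by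
  have h := Sym2.card_subtype_not_diag (α := Fin n)
  rw [Fintype.card_fin] at h
  rw [← h]

lemma choose_two_pos {n : ℕ} (hn : 2 ≤ n) : 0 < (n.choose 2 : ℝ) := by
  exact_mod_cast Nat.choose_pos hn

lemma isClosed_simplex (n : ℕ) (L : ℝ) (α : Edge n → ℝ) : IsClosed (simplex n L α) := by
  have h : simplex n L α = (⋂ e, {x : Edge n → ℝ | 0 ≤ x e}) ∩ {x | ∑ e, α e * x e ≤ L} := by
    ext x; simp [simplex]
  rw [h]
  refine (isClosed_iInter fun e => isClosed_le continuous_const (continuous_apply e)).inter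
    (isClosed_le ?_ continuous_const)
  fun_prop

open scoped Pointwise in
lemma simplex_smul {n : ℕ} {r : ℝ} (hr : 0 < r) (L : ℝ) (α : Edge n → ℝ) :
    simplex n (r * L) α = r • simplex n L α := by
  ext x
  rw [Set.mem_smul_set_iff_inv_smul_mem₀ hr.ne']
  simp only [simplex, Set.mem_ofPred_eq, Pi.smul_apply, smul_eq_mul]
  have h : ∑ e, α e * (r⁻¹ * x e) = r⁻¹ * ∑ e, α e * x e := by
    rw [Finset.mul_sum]; exact Finset.sum_congr rfl fun e _ => by ring
  rw [h, inv_mul_le_iff₀ hr]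
  refine and_congr_left fun _ => forall_congr' fun e => ?_
  rw [mul_nonneg_iff_of_pos_left (inv_pos.2 hr)]

lemma volume_simplex_mul {n : ℕ} {r : ℝ} (hr : 0 < r) (L : ℝ) (α : Edge n → ℝ) :
    volume (simplex n (r * L) α) = ENNReal.ofReal (r ^ n.choose 2) * volume (simplex n L α) := by
  rw [simplex_smul hr, Measure.addHaar_smul, Module.finrank_fintype_fun_eq_card, card_edge,
    abs_of_pos (pow_pos hr _)]

lemma volume_simplex_of_nonpos {n : ℕ} (hn : 2 ≤ n) {L : ℝ} (hL : L ≤ 0) {α : Edge n → ℝ}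
    (hα : ∀ e, 0 < α e) : volume (simplex n L α) = 0 := by
  have hc : 0 < Fintype.card (Edge n) := by rw [card_edge]; exact Nat.choose_pos hn
  obtain ⟨e⟩ := Fintype.card_pos_iff.1 hc
  refine measure_mono_null (t := {x : Edge n → ℝ | x e = 0}) ?_ (Measure.pi_hyperplane _ e 0)
  rintro x ⟨h0, h1⟩
  have h2 : α e * x e ≤ ∑ e, α e * x e :=
    Finset.single_le_sum (f := fun e => α e * x e)
      (fun i _ => mul_nonneg (hα i).le (h0 i)) (Finset.mem_univ e)
  have h3 : α e * x e ≤ 0 := by linarith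
  exact le_antisymm (nonpos_of_mul_nonpos_right h3 (hα e)) (h0 e)

lemma volume_simplex_ne_top {n : ℕ} (L : ℝ) {α : Edge n → ℝ}
    (hα : ∀ e, 0 < α e) : volume (simplex n L α) ≠ ⊤ := by
  have hsub : simplex n L α ⊆ Set.Icc 0 (fun e => L / α e) := by
    rintro x ⟨h0, h1⟩
    refine ⟨h0, fun e => ?_⟩
    have h2 : α e * x e ≤ ∑ e, α e * x e :=
      Finset.single_le_sum (f := fun e => α e * x e)
        (fun i _ => mul_nonneg (hα i).le (h0 i)) (Finset.mem_univ e)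
    rw [le_div_iff₀ (hα e)]
    linarith
  exact ne_top_of_le_ne_top (isCompact_Icc.measure_lt_top (μ := volume)).ne (measure_mono hsub)

lemma volume_simplex_ne_zero {n : ℕ} {L : ℝ} (hL : 0 < L) {α : Edge n → ℝ}
    (hα : ∀ e, 0 < α e) : volume (simplex n L α) ≠ 0 := by
  set m : ℝ := Fintype.card (Edge n) + 1
  have hm : 0 < m := by positivity
  have hsub : Set.Icc 0 (fun e => L / (m * α e)) ⊆ simplex n L α := by
    rintro x ⟨h0, h1⟩
    refine ⟨h0, ?_⟩
    calc ∑ e, α e * x e ≤ ∑ _e : Edge n, L / m := by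
          refine Finset.sum_le_sum fun e _ => ?_
          have := h1 e
          simp only at this
          rw [le_div_iff₀ (mul_pos hm (hα e))] at this
          rw [le_div_iff₀ hm]; linarith
      _ = (m - 1) * (L / m) := by simp [m]
      _ ≤ L := by
          rw [mul_div_assoc', div_le_iff₀ hm]; nlinarith
  intro h
  have h0 := measure_mono_null hsub h
  rw [Real.volume_Icc_pi] at h0
  have := Finset.prod_eq_zero_iff.1 h0
  obtain ⟨e, -, he⟩ := this
  have : 0 < L / (m * α e) := div_pos hL (mul_pos hm (hα e))
  simp only [Pi.zero_apply, sub_zero, ENNReal.ofReal_eq_zero] at he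
  linarith

/-- Cutting off a corner: the points of the simplex whose coordinates in `A` exceed `p` form, up
to a null set, a translate of a smaller simplex. -/
lemma volume_simplex_inter_lt {n : ℕ} (L : ℝ) (α : Edge n → ℝ) {p : ℝ} (hp : 0 ≤ p)
    (A : Finset (Edge n)) :
    volume (simplex n L α ∩ {x | ∀ e ∈ A, p < x e}) =
      volume (simplex n (L - (∑ e ∈ A, α e) * p) α) := by
  classical
  set t : Edge n → ℝ := fun e => if e ∈ A then p else 0
  have hpre : (fun x => x + -t) ⁻¹' simplex n (L - (∑ e ∈ A, α e) * p) α =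
      simplex n L α ∩ {x | ∀ e ∈ A, p ≤ x e} := by
    ext x
    have hs : ∑ e, α e * t e = (∑ e ∈ A, α e) * p := by
      simp [t, Finset.sum_ite_mem, Finset.sum_mul]
    simp only [simplex, Set.mem_preimage, Set.mem_ofPred_eq, Pi.add_apply, Pi.neg_apply, mul_add,
      Finset.sum_add_distrib, mul_neg, Finset.sum_neg_distrib, hs, Set.mem_inter_iff]
    constructor
    · rintro ⟨h1, h2⟩
      refine ⟨⟨fun e => ?_, by linarith⟩, fun e he => ?_⟩
      · have := h1 e
        by_cases he : e ∈ A
        · simp only [t, he, if_true] at this; linarith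
        · simp only [t, he, if_false] at this; linarith
      · have := h1 e
        simp only [t, he, if_true] at this; linarith
    · rintro ⟨⟨h1, h2⟩, h3⟩
      refine ⟨fun e => ?_, by linarith⟩
      by_cases he : e ∈ A
      · simp only [t, he, if_true]; linarith [h3 e he]
      · simp only [t, he, if_false]; linarith [h1 e]
  rw [← measure_preimage_add_right volume (-t) (simplex n (L - (∑ e ∈ A, α e) * p) α), hpre]
  refine measure_congr ?_
  have hae : ∀ᵐ x : Edge n → ℝ, ∀ e, x e ≠ p :=
    ae_all_iff.2 fun e => Measure.ae_eval_ne (α := fun _ => ℝ) (fun _ => volume) e p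
  filter_upwards [hae] with x hx
  refine propext (and_congr_right fun _ => forall₂_congr fun e _ => ?_)
  exact ⟨le_of_lt, fun h => lt_of_le_of_ne h (hx e).symm⟩

lemma measurableSet_lt (n : ℕ) (p : ℝ) (A : Finset (Edge n)) :
    MeasurableSet {x : Edge n → ℝ | ∀ e ∈ A, p < x e} := by
  have : {x : Edge n → ℝ | ∀ e ∈ A, p < x e} = ⋂ e ∈ A, {x | p < x e} := by ext; simp
  rw [this]
  exact Finset.measurableSet_biInter _ fun e _ =>
    _root_.measurableSet_lt measurable_const (measurable_pi_apply e)

lemma isProbabilityMeasure_law {n : ℕ} (hn : 2 ≤ n) {α : Edge n → ℝ} (hα : ∀ e, 0 < α e) :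
    IsProbabilityMeasure (law n α) :=
  ProbabilityTheory.cond_isProbabilityMeasure_of_finite
    (volume_simplex_ne_zero (choose_two_pos hn) hα) (volume_simplex_ne_top _ hα)

/-- The ratio of the volume of the cut-off simplex to that of the whole one. For
`α(A) p ≥ N` nothing is left, hence the truncation at `0`. -/
lemma law_real_lt {n : ℕ} (hn : 2 ≤ n) {α : Edge n → ℝ} (hα : ∀ e, 0 < α e) {p : ℝ} (hp : 0 ≤ p)
    (A : Finset (Edge n)) :
    (law n α).real {x | ∀ e ∈ A, p < x e} =
      max 0 (1 - (∑ e ∈ A, α e) * p / (n.choose 2 : ℝ)) ^ n.choose 2 := by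
  have hN := choose_two_pos hn
  have hc : n.choose 2 ≠ 0 := (Nat.choose_pos hn).ne'
  set N : ℝ := (n.choose 2 : ℝ) with hNdef
  set r : ℝ := 1 - (∑ e ∈ A, α e) * p / N with hr
  have hL : N - (∑ e ∈ A, α e) * p = r * N := by rw [hr]; field_simp
  have h0 := volume_simplex_ne_zero hN hα
  have h1 := volume_simplex_ne_top N hα
  rw [measureReal_def, law, ProbabilityTheory.cond_apply (isClosed_simplex n _ α).measurableSet,
    volume_simplex_inter_lt N α hp A, hL]
  rcases le_or_gt r 0 with h | h
  · rw [volume_simplex_of_nonpos hn (mul_nonpos_of_nonpos_of_nonneg h hN.le) hα, max_eq_left h,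
      zero_pow hc]
    simp
  · rw [volume_simplex_mul h, max_eq_right h.le, mul_comm, mul_assoc, ENNReal.mul_inv_cancel h0 h1,
      mul_one, ENNReal.toReal_ofReal (pow_nonneg h.le _)]

/-! ### Reduction to finite sums over the set of absent edges -/

/-- The edges of `[n]` that are missing from `thresholdGraph x p`. -/
noncomputable def absent {n : ℕ} (x : Edge n → ℝ) (p : ℝ) : Finset (Edge n) :=
  Finset.univ.filter fun e => p < x e

/-- The graph whose missing edges are exactly those in `A`. -/
def graphOf {n : ℕ} (A : Finset (Edge n)) : SimpleGraph (Fin n) where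
  Adj v w := ∃ h : ¬ (s(v, w) : Sym2 (Fin n)).IsDiag, (⟨s(v, w), h⟩ : Edge n) ∉ A
  symm := ⟨fun v w => by
    rintro ⟨h, hx⟩
    have hs : (s(v, w) : Sym2 (Fin n)) = s(w, v) := Sym2.eq_swap
    refine ⟨hs ▸ h, ?_⟩
    have he : (⟨s(w, v), hs ▸ h⟩ : Edge n) = ⟨s(v, w), h⟩ := Subtype.ext hs.symm
    rw [he]
    exact hx⟩
  loopless := ⟨fun v => by
    rintro ⟨h, -⟩
    exact h rfl⟩

lemma thresholdGraph_eq {n : ℕ} (x : Edge n → ℝ) (p : ℝ) :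
    thresholdGraph x p = graphOf (absent x p) := by
  ext v w
  simp [thresholdGraph, graphOf, absent]

/-- The probability that the set of absent edges equals `A`. -/
noncomputable def mass {n : ℕ} (α : Edge n → ℝ) (p : ℝ) (A : Finset (Edge n)) : ℝ :=
  (law n α).real {x | absent x p = A}

/-- The expectation of a function of the set of absent edges, as a finite sum. -/
noncomputable def expect {n : ℕ} (α : Edge n → ℝ) (p : ℝ) (f : Finset (Edge n) → ℝ) : ℝ :=
  ∑ A, mass α p A * f A

/-- The probability of an event depending on the set of absent edges. -/
noncomputable def prob {n : ℕ} (α : Edge n → ℝ) (p : ℝ) (Q : Finset (Edge n) → Prop) : ℝ :=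
  (law n α).real {x | Q (absent x p)}

lemma probConnected_eq {n : ℕ} (α : Edge n → ℝ) (p : ℝ) :
    probConnected n α p = prob α p fun A => (graphOf A).Connected := by
  simp only [probConnected, prob, thresholdGraph_eq]

lemma measurableSet_absent {n : ℕ} (p : ℝ) (A : Finset (Edge n)) :
    MeasurableSet {x : Edge n → ℝ | absent x p = A} := by
  have : {x : Edge n → ℝ | absent x p = A} = ⋂ e, {x | p < x e ↔ e ∈ A} := by
    ext x
    simp only [absent, Set.mem_ofPred_eq, Set.mem_iInter, Finset.ext_iff, Finset.mem_filter,
      Finset.mem_univ, true_and]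
  rw [this]
  refine MeasurableSet.iInter fun e => ?_
  have hm : MeasurableSet {x : Edge n → ℝ | p < x e} :=
    _root_.measurableSet_lt measurable_const (measurable_pi_apply e)
  by_cases he : e ∈ A
  · simpa [he] using hm
  · have h : {x : Edge n → ℝ | p < x e ↔ e ∈ A} = {x | p < x e}ᶜ := by ext x; simp [he]
    rw [h]; exact hm.compl

lemma mass_nonneg {n : ℕ} (α : Edge n → ℝ) (p : ℝ) (A : Finset (Edge n)) : 0 ≤ mass α p A :=
  measureReal_nonneg

section

variable {n : ℕ} {α : Edge n → ℝ} {p : ℝ}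

lemma expect_mono {f g : Finset (Edge n) → ℝ} (h : ∀ A, f A ≤ g A) :
    expect α p f ≤ expect α p g :=
  Finset.sum_le_sum fun A _ => mul_le_mul_of_nonneg_left (h A) (mass_nonneg α p A)

lemma expect_add (f g : Finset (Edge n) → ℝ) :
    expect α p (fun A => f A + g A) = expect α p f + expect α p g := by
  simp [expect, mul_add, Finset.sum_add_distrib]

lemma expect_const_mul (c : ℝ) (f : Finset (Edge n) → ℝ) :
    expect α p (fun A => c * f A) = c * expect α p f := by
  simp only [expect, Finset.mul_sum]
  exact Finset.sum_congr rfl fun _ _ => by ring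

lemma expect_sum {ι : Type*} (s : Finset ι) (f : ι → Finset (Edge n) → ℝ) :
    expect α p (fun A => ∑ i ∈ s, f i A) = ∑ i ∈ s, expect α p (f i) := by
  simp only [expect, Finset.mul_sum]
  exact Finset.sum_comm

open Classical in
lemma prob_eq_expect (hn : 2 ≤ n) (hα : ∀ e, 0 < α e) (Q : Finset (Edge n) → Prop) :
    prob α p Q = expect α p fun A => if Q A then 1 else 0 := by
  have := isProbabilityMeasure_law hn hα
  have h : {x : Edge n → ℝ | Q (absent x p)} =
      ⋃ A ∈ Finset.univ.filter Q, {x | absent x p = A} := by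
    ext x; simp
  rw [prob, h, measureReal_biUnion_finset]
  · rw [Finset.sum_filter, expect]
    exact Finset.sum_congr rfl fun A _ => by simp [mass]
  · intro A _ B _ hAB
    refine Set.disjoint_left.2 fun x hx hx' => hAB ?_
    exact hx.symm.trans hx'
  · exact fun A _ => measurableSet_absent p A

lemma prob_mono (hn : 2 ≤ n) (hα : ∀ e, 0 < α e) {Q R : Finset (Edge n) → Prop}
    (h : ∀ A, Q A → R A) : prob α p Q ≤ prob α p R := by
  have := isProbabilityMeasure_law hn hα
  exact measureReal_mono fun x hx => h _ hx

lemma prob_nonneg (Q : Finset (Edge n) → Prop) : 0 ≤ prob α p Q := measureReal_nonneg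

lemma prob_true (hn : 2 ≤ n) (hα : ∀ e, 0 < α e) : prob α p (fun _ => True) = 1 := by
  have := isProbabilityMeasure_law hn hα
  simp [prob]

lemma expect_const (hn : 2 ≤ n) (hα : ∀ e, 0 < α e) (c : ℝ) : expect α p (fun _ => c) = c := by
  have h := prob_true (p := p) hn hα
  rw [prob_eq_expect hn hα] at h
  have h2 := expect_const_mul (α := α) (p := p) c fun _ => if True then 1 else 0
  simp only [if_true] at h h2
  simpa [h] using h2

lemma prob_and_add (hn : 2 ≤ n) (hα : ∀ e, 0 < α e) (Q R : Finset (Edge n) → Prop) :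
    prob α p (fun A => Q A ∧ R A) + prob α p (fun A => Q A ∧ ¬ R A) = prob α p Q := by
  classical
  simp only [prob_eq_expect hn hα, ← expect_add]
  refine congrArg _ (funext fun A => ?_)
  by_cases h1 : Q A <;> by_cases h2 : R A <;> simp [h1, h2]

lemma prob_not (hn : 2 ≤ n) (hα : ∀ e, 0 < α e) (Q : Finset (Edge n) → Prop) :
    prob α p (fun A => ¬ Q A) = 1 - prob α p Q := by
  have h := prob_and_add (p := p) hn hα (fun _ => True) Q
  simp only [true_and, prob_true hn hα] at h
  linarith

/-- The union bound. -/
lemma prob_le_sum {ι : Type*} (hn : 2 ≤ n) (hα : ∀ e, 0 < α e) (s : Finset ι)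
    {Q : Finset (Edge n) → Prop} {R : ι → Finset (Edge n) → Prop}
    (h : ∀ A, Q A → ∃ i ∈ s, R i A) : prob α p Q ≤ ∑ i ∈ s, prob α p (R i) := by
  classical
  simp only [prob_eq_expect hn hα, ← expect_sum]
  refine expect_mono fun A => ?_
  have hnn : ∀ i ∈ s, (0 : ℝ) ≤ if R i A then 1 else 0 := fun i _ => by split_ifs <;> norm_num
  by_cases hQ : Q A
  · obtain ⟨i, hi, hR⟩ := h A hQ
    have := Finset.single_le_sum hnn hi
    simpa [hQ, hR] using this
  · simp only [hQ, if_false]; exact Finset.sum_nonneg hnn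

/-- The probability that all edges of `B` are absent. -/
lemma prob_superset (hn : 2 ≤ n) (hα : ∀ e, 0 < α e) (hp : 0 ≤ p) (B : Finset (Edge n)) :
    prob α p (fun A => B ⊆ A) =
      max 0 (1 - (∑ e ∈ B, α e) * p / (n.choose 2 : ℝ)) ^ n.choose 2 := by
  rw [← law_real_lt hn hα hp B, prob]
  congr 1
  ext x
  simp [Finset.subset_iff, absent]

lemma prob_superset_le_exp (hn : 2 ≤ n) (hα : ∀ e, 0 < α e) (hp : 0 ≤ p) (B : Finset (Edge n)) :
    prob α p (fun A => B ⊆ A) ≤ Real.exp (-((∑ e ∈ B, α e) * p)) := by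
  have hN := choose_two_pos hn
  rw [prob_superset hn hα hp]
  calc _ ≤ Real.exp (-((∑ e ∈ B, α e) * p / (n.choose 2 : ℝ))) ^ n.choose 2 := by
        refine pow_le_pow_left₀ (le_max_left _ _) (max_le (Real.exp_pos _).le ?_) _
        linarith [Real.add_one_le_exp (-((∑ e ∈ B, α e) * p / (n.choose 2 : ℝ)))]
    _ = _ := by
        rw [← Real.exp_nat_mul]; congr 1; field_simp

lemma pow_sub_pow_le {x y : ℝ} (hy : 0 ≤ y) (hyx : y ≤ x) (N : ℕ) :
    x ^ N - y ^ N ≤ N * (x - y) * x ^ (N - 1) := by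
  have hx := hy.trans hyx
  rw [← Commute.geom_sum₂_mul (Commute.all x y) N]
  have : ∑ i ∈ Finset.range N, x ^ i * y ^ (N - 1 - i) ≤ ∑ _i ∈ Finset.range N, x ^ (N - 1) := by
    refine Finset.sum_le_sum fun i hi => ?_
    rw [Finset.mem_range] at hi
    calc x ^ i * y ^ (N - 1 - i) ≤ x ^ i * x ^ (N - 1 - i) := by gcongr
      _ = x ^ (N - 1) := by rw [← pow_add]; congr 1; omega
  rw [Finset.sum_const, Finset.card_range, nsmul_eq_mul] at this
  have h2 : 0 ≤ x - y := by linarith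
  nlinarith [mul_le_mul_of_nonneg_right this h2]

/-- An edge is present, while a given set of other edges is absent, with probability at most of
order `p` times the probability that the other edges are absent. -/
lemma prob_superset_present_le (hn : 3 ≤ n) (hα : ∀ e, 0 < α e) (hp : 0 ≤ p)
    (B : Finset (Edge n)) {e : Edge n} (he : e ∉ B) :
    prob α p (fun A => B ⊆ A ∧ e ∉ A) ≤
      α e * p * Real.exp 1 * Real.exp (-((∑ e ∈ B, α e) * p)) := by
  classical
  have hn2 : 2 ≤ n := by omega
  have hN := choose_two_pos hn2
  have hαe := hα e
  have h1 := prob_and_add (p := p) hn2 hα (fun A => B ⊆ A) (fun A => e ∈ A)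
  have h2 : prob α p (fun A => B ⊆ A ∧ e ∈ A) = prob α p (fun A => insert e B ⊆ A) := by
    congr 1; ext A; rw [Finset.insert_subset_iff, and_comm]
  rw [h2, prob_superset hn2 hα hp, prob_superset hn2 hα hp, Finset.sum_insert he] at h1
  set N := n.choose 2 with hNdef
  set b := ∑ e ∈ B, α e
  have hb : 0 ≤ b := Finset.sum_nonneg fun e _ => (hα e).le
  set x := max 0 (1 - b * p / (N : ℝ))
  set y := max 0 (1 - (α e + b) * p / (N : ℝ))
  have hz : 0 ≤ α e * p / N := by positivity
  have hsplit : (α e + b) * p / (N : ℝ) = b * p / N + α e * p / N := by ring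
  have hyx : y ≤ x := max_le_max le_rfl (by linarith)
  have hxy : x - y ≤ α e * p / N := by
    rcases le_total (1 - b * p / (N : ℝ)) 0 with h | h
    · have : x = 0 := max_eq_left h
      have : 0 ≤ y := le_max_left _ _
      linarith
    · have : x = _ := max_eq_right h
      have : 1 - (α e + b) * p / (N : ℝ) ≤ y := le_max_right _ _
      linarith
  have h3 := pow_sub_pow_le (le_max_left 0 _) hyx N
  have h4 : x ^ (N - 1) ≤ Real.exp 1 * Real.exp (-(b * p)) := by
    have hx0 : 0 ≤ x := le_max_left _ _
    rcases le_total (1 - b * p / (N : ℝ)) 0 with h | h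
    · have hx : x = 0 := max_eq_left h
      have h0 : N - 1 ≠ 0 := by
        have := Nat.choose_le_choose 2 hn
        rw [← hNdef] at this
        norm_num [Nat.choose] at this
        omega
      rw [hx, zero_pow h0]; positivity
    · have hle : b * p / N ≤ 1 := by linarith
      calc x ^ (N - 1) ≤ Real.exp (-(b * p / N)) ^ (N - 1) := by
            refine pow_le_pow_left₀ hx0 (max_le (Real.exp_pos _).le ?_) _
            linarith [Real.add_one_le_exp (-(b * p / N))]
        _ = Real.exp (b * p / N + -(b * p)) := by
            rw [← Real.exp_nat_mul, Nat.cast_sub (Nat.choose_pos hn2)]; congr 1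
            push_cast; field_simp; ring
        _ ≤ _ := by rw [← Real.exp_add]; gcongr
  have h5 : 0 ≤ x ^ (N - 1) := pow_nonneg (le_max_left _ _) _
  calc _ = x ^ N - y ^ N := by linarith
    _ ≤ N * (x - y) * x ^ (N - 1) := h3
    _ ≤ N * (α e * p / N) * x ^ (N - 1) := by gcongr
    _ = α e * p * x ^ (N - 1) := by field_simp
    _ ≤ α e * p * (Real.exp 1 * Real.exp (-(b * p))) := by gcongr
    _ = _ := by ring

lemma probConnected_nonneg : 0 ≤ probConnected n α p := measureReal_nonneg

lemma probConnected_le_one (hn : 2 ≤ n) (hα : ∀ e, 0 < α e) : probConnected n α p ≤ 1 := by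
  have := isProbabilityMeasure_law hn hα
  exact measureReal_le_one

lemma probConnected_mono (hn : 2 ≤ n) (hα : ∀ e, 0 < α e) {q : ℝ} (hpq : p ≤ q) :
    probConnected n α p ≤ probConnected n α q := by
  have := isProbabilityMeasure_law hn hα
  refine measureReal_mono fun x hx => SimpleGraph.Connected.mono ?_ hx
  rintro v w ⟨h, hvw⟩
  exact ⟨h, hvw.trans hpq⟩

end

/-! ### Cuts and stars -/

section

variable {n : ℕ}

/-- The edges with exactly one endpoint in `S`. -/
noncomputable def cut (S : Finset (Fin n)) : Finset (Edge n) :=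
  open Classical in
  Finset.univ.filter fun e => (∃ v ∈ S, v ∈ e.1) ∧ ∃ w, w ∉ S ∧ w ∈ e.1

/-- The edges with both endpoints in `S`. -/
noncomputable def inside (S : Finset (Fin n)) : Finset (Edge n) :=
  open Classical in
  Finset.univ.filter fun e => ∀ v ∈ e.1, v ∈ S

/-- The edges at the vertex `v`; all of them are absent exactly when `v` is isolated. -/
def star (v : Fin n) : Finset (Edge n) :=
  (Finset.univ : Finset (Edge n)).filter (fun e => v ∈ e.1)

/-- The coefficient of the edge `vw`, and `0` if `v = w`. -/
noncomputable def pairWeight (α : Edge n → ℝ) (v w : Fin n) : ℝ :=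
  if h : (s(v, w) : Sym2 (Fin n)).IsDiag then 0 else α ⟨s(v, w), h⟩

lemma mem_cut {S : Finset (Fin n)} {v w : Fin n} (h : ¬ (s(v, w) : Sym2 (Fin n)).IsDiag) :
    (⟨s(v, w), h⟩ : Edge n) ∈ cut S ↔ (v ∈ S ∧ w ∉ S) ∨ (w ∈ S ∧ v ∉ S) := by
  simp only [cut, Finset.mem_filter, Finset.mem_univ, true_and, Sym2.mem_iff]
  constructor
  · rintro ⟨⟨a, ha, rfl | rfl⟩, b, hb, rfl | rfl⟩ <;> tauto
  · rintro (⟨h1, h2⟩ | ⟨h1, h2⟩)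
    · exact ⟨⟨v, h1, Or.inl rfl⟩, w, h2, Or.inr rfl⟩
    · exact ⟨⟨w, h1, Or.inr rfl⟩, v, h2, Or.inl rfl⟩

lemma mem_inside {S : Finset (Fin n)} {v w : Fin n} (h : ¬ (s(v, w) : Sym2 (Fin n)).IsDiag) :
    (⟨s(v, w), h⟩ : Edge n) ∈ inside S ↔ v ∈ S ∧ w ∈ S := by
  simp [inside, Sym2.mem_iff]

lemma mem_star {u v w : Fin n} (h : ¬ (s(v, w) : Sym2 (Fin n)).IsDiag) :
    (⟨s(v, w), h⟩ : Edge n) ∈ star u ↔ u = v ∨ u = w := by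
  simp [star, Sym2.mem_iff]

lemma edge_ind {P : Edge n → Prop}
    (h : ∀ (v w : Fin n) (h : ¬ (s(v, w) : Sym2 (Fin n)).IsDiag), P ⟨s(v, w), h⟩) (e : Edge n) :
    P e := by
  obtain ⟨e, he⟩ := e
  induction e using Sym2.ind with
  | _ v w => exact h v w he

lemma cut_singleton (v : Fin n) : cut {v} = star v := by
  ext e
  induction e using edge_ind with
  | h a b h =>
    rw [mem_cut, mem_star]
    have : a ≠ b := fun hab => h (Sym2.mk_isDiag_iff.2 hab)
    simp only [Finset.mem_singleton]
    constructor
    · rintro (⟨h, -⟩ | ⟨h, -⟩)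
      exacts [Or.inl h.symm, Or.inr h.symm]
    · rintro (rfl | rfl)
      exacts [Or.inl ⟨rfl, this.symm⟩, Or.inr ⟨rfl, this⟩]

lemma vertexWeight_eq (α : Edge n → ℝ) (v : Fin n) : vertexWeight α v = ∑ e ∈ star v, α e := rfl

lemma sum_cut (α : Edge n → ℝ) (S : Finset (Fin n)) :
    ∑ e ∈ cut S, α e = ∑ v ∈ S, ∑ w ∈ Sᶜ, pairWeight α v w := by
  rw [← Finset.sum_product']
  symm
  have hd : ∀ a ∈ S ×ˢ Sᶜ, ¬ (s(a.1, a.2) : Sym2 (Fin n)).IsDiag := by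
    rintro ⟨a, b⟩ h
    rw [Finset.mem_product, Finset.mem_compl] at h
    rw [Sym2.mk_isDiag_iff]
    intro hab
    exact h.2 (Set.mem_of_eq_of_mem (s := S) hab.symm h.1)
  refine Finset.sum_bij (fun a ha => ⟨s(a.1, a.2), hd a ha⟩) ?_ ?_ ?_ ?_
  · rintro ⟨a, b⟩ h
    rw [Finset.mem_product, Finset.mem_compl] at h
    exact (mem_cut _).2 (Or.inl h)
  · rintro ⟨a, b⟩ h ⟨a', b'⟩ h' he
    rw [Finset.mem_product, Finset.mem_compl] at h h'
    have := congrArg Subtype.val he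
    simp only [Sym2.eq_iff] at this
    rcases this with ⟨rfl, rfl⟩ | ⟨rfl, rfl⟩
    · rfl
    · exact absurd h.1 h'.2
  · intro e
    induction e using edge_ind with
    | h a b h =>
      rw [mem_cut]
      rintro (h1 | h1)
      · exact ⟨(a, b), by simpa using h1, rfl⟩
      · exact ⟨(b, a), by simpa using h1, Subtype.ext Sym2.eq_swap⟩
  · rintro ⟨a, b⟩ h
    simp [pairWeight, hd _ h]

lemma pairWeight_self (α : Edge n → ℝ) (v : Fin n) : pairWeight α v v = 0 := by
  simp [pairWeight]

lemma vertexWeight_eq_sum (α : Edge n → ℝ) (v : Fin n) :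
    vertexWeight α v = ∑ w, pairWeight α v w := by
  rw [vertexWeight_eq, ← cut_singleton, sum_cut, Finset.sum_singleton,
    ← Finset.sum_add_sum_compl {v}, Finset.sum_singleton, pairWeight_self, zero_add]

lemma pairWeight_le {α : Edge n → ℝ} {b : ℝ} (hb : 0 ≤ b) (h : ∀ e, α e ≤ b) (v w : Fin n) :
    pairWeight α v w ≤ b := by
  unfold pairWeight
  split_ifs
  exacts [hb, h _]

lemma le_sum_cut {α : Edge n → ℝ} {m : ℝ} (h : ∀ e, m ≤ α e) (S : Finset (Fin n)) :
    (S.card : ℝ) * (n - S.card) * m ≤ ∑ e ∈ cut S, α e := by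
  rw [sum_cut]
  have hc : ((Sᶜ).card : ℝ) = n - S.card := by
    rw [Finset.card_compl, Fintype.card_fin, Nat.cast_sub (by simpa using S.card_le_univ)]
  calc _ = ∑ v ∈ S, ∑ w ∈ Sᶜ, m := by simp [hc]; ring
    _ ≤ _ := by
      refine Finset.sum_le_sum fun v hv => Finset.sum_le_sum fun w hw => ?_
      rw [Finset.mem_compl] at hw
      rw [pairWeight, dif_neg]
      · exact h _
      · rw [Sym2.mk_isDiag_iff]; rintro rfl; exact hw hv

lemma sum_cut_le {α : Edge n → ℝ} {b : ℝ} (hb : 0 ≤ b) (h : ∀ e, α e ≤ b) (S : Finset (Fin n)) :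
    ∑ e ∈ cut S, α e ≤ (S.card : ℝ) * (n - S.card) * b := by
  rw [sum_cut]
  have hc : ((Sᶜ).card : ℝ) = n - S.card := by
    rw [Finset.card_compl, Fintype.card_fin, Nat.cast_sub (by simpa using S.card_le_univ)]
  calc _ ≤ ∑ v ∈ S, ∑ w ∈ Sᶜ, b :=
        Finset.sum_le_sum fun v _ => Finset.sum_le_sum fun w _ => pairWeight_le hb h v w
    _ = _ := by simp [hc]; ring

lemma sum_vertexWeight_sub_le_sum_cut {α : Edge n → ℝ} {b : ℝ} (hb : 0 ≤ b) (h : ∀ e, α e ≤ b)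
    (S : Finset (Fin n)) :
    ∑ v ∈ S, vertexWeight α v - (S.card : ℝ) ^ 2 * b ≤ ∑ e ∈ cut S, α e := by
  rw [sum_cut, sub_le_iff_le_add]
  calc ∑ v ∈ S, vertexWeight α v
      = ∑ v ∈ S, ((∑ w ∈ Sᶜ, pairWeight α v w) + ∑ w ∈ S, pairWeight α v w) := by
        refine Finset.sum_congr rfl fun v _ => ?_
        rw [vertexWeight_eq_sum, add_comm, Finset.sum_add_sum_compl]
    _ ≤ ∑ v ∈ S, ((∑ w ∈ Sᶜ, pairWeight α v w) + ∑ w ∈ S, b) :=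
        Finset.sum_le_sum fun v _ => by
          gcongr with w _
          exact pairWeight_le hb h v w
    _ = _ := by rw [Finset.sum_add_distrib]; simp; ring

lemma le_vertexWeight {α : Edge n → ℝ} {m : ℝ} (h : ∀ e, m ≤ α e) (v : Fin n) :
    ((n : ℝ) - 1) * m ≤ vertexWeight α v := by
  simpa [vertexWeight_eq, cut_singleton] using le_sum_cut h {v}

lemma vertexWeight_le {α : Edge n → ℝ} {b : ℝ} (hb : 0 ≤ b) (h : ∀ e, α e ≤ b) (v : Fin n) :
    vertexWeight α v ≤ ((n : ℝ) - 1) * b := by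
  simpa [vertexWeight_eq, cut_singleton] using sum_cut_le hb h {v}

lemma le_sum_star_union {α : Edge n → ℝ} {b : ℝ} (hb : 0 ≤ b) (h : ∀ e, α e ≤ b) {v w : Fin n}
    (hvw : v ≠ w) :
    vertexWeight α v + vertexWeight α w - b ≤ ∑ e ∈ star v ∪ star w, α e := by
  have h1 := Finset.sum_union_inter (s₁ := star v) (s₂ := star w) (f := α)
  have h2 : (star v ∩ star w).card ≤ 1 := by
    rw [Finset.card_le_one]
    have key : ∀ e ∈ star v ∩ star w, e.1 = s(v, w) := by
      intro e he
      rw [Finset.mem_inter, star, star, Finset.mem_filter, Finset.mem_filter] at he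
      exact (Sym2.mem_and_mem_iff hvw).1 ⟨he.1.2, he.2.2⟩
    intro a ha c hc
    exact Subtype.ext ((key a ha).trans (key c hc).symm)
  have h3 : ∑ e ∈ star v ∩ star w, α e ≤ b := by
    calc _ ≤ ∑ _e ∈ star v ∩ star w, b := Finset.sum_le_sum fun e _ => h e
      _ = (star v ∩ star w).card * b := by simp
      _ ≤ 1 * b := by gcongr; exact_mod_cast h2
      _ = b := one_mul b
  rw [vertexWeight_eq, vertexWeight_eq]
  linarith

lemma card_inside (S : Finset (Fin n)) : (inside S).card = S.card.choose 2 := by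
  classical
  rw [← Sym2.card_image_offDiag, ← Finset.card_image_of_injective (inside S) Subtype.val_injective]
  congr 1
  ext e
  induction e using Sym2.ind with
  | _ v w =>
    simp only [Finset.mem_image, Subtype.exists, exists_and_right, exists_eq_right,
      Finset.mem_offDiag, Prod.exists]
    constructor
    · rintro ⟨hd, h⟩
      rw [mem_inside] at h
      exact ⟨v, w, ⟨h.1, h.2, fun hvw => hd (Sym2.mk_isDiag_iff.2 hvw)⟩, rfl⟩
    · rintro ⟨a, b, ⟨ha, hb, hab⟩, he⟩
      have he' : s(a, b) = s(v, w) := he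
      rw [← he']
      exact ⟨fun h => hab (Sym2.mk_isDiag_iff.1 h), (mem_inside _).2 ⟨ha, hb⟩⟩

lemma card_biUnion_star (S : Finset (Fin n)) :
    ((S.biUnion star).card : ℝ) = n.choose 2 - (n - S.card).choose 2 := by
  classical
  have h1 : S.biUnion star = (inside Sᶜ)ᶜ := by
    ext e
    simp only [Finset.mem_biUnion, star, Finset.mem_filter, Finset.mem_univ, true_and, inside,
      Finset.mem_compl, not_forall, not_not]
    exact ⟨fun ⟨a, b, c⟩ => ⟨a, c, b⟩, fun ⟨a, b, c⟩ => ⟨a, c, b⟩⟩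
  have h2 : (inside Sᶜ).card = (n - S.card).choose 2 := by
    rw [card_inside, Finset.card_compl, Fintype.card_fin]
  rw [h1, Finset.card_compl, card_edge, h2, Nat.cast_sub]
  exact Nat.choose_le_choose 2 (Nat.sub_le _ _)

/-! ### Connectivity in terms of cuts -/

lemma cut_compl (S : Finset (Fin n)) : cut Sᶜ = cut S := by
  ext e
  induction e using edge_ind with
  | h a b h => rw [mem_cut, mem_cut]; simp only [Finset.mem_compl]; tauto

lemma exists_cut_subset {A : Finset (Edge n)} (hn : 0 < n) (h : ¬ (graphOf A).Connected) :
    ∃ S : Finset (Fin n), S.Nonempty ∧ 2 * S.card ≤ n ∧ cut S ⊆ A := by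
  classical
  have : Nonempty (Fin n) := ⟨⟨0, hn⟩⟩
  have hp : ¬ (graphOf A).Preconnected := fun hp => h ⟨hp⟩
  simp only [SimpleGraph.Preconnected, not_forall] at hp
  obtain ⟨u, v, huv⟩ := hp
  set S : Finset (Fin n) := Finset.univ.filter fun w => (graphOf A).Reachable u w
  have key : ∀ a b, a ∈ S → b ∉ S → ∀ hd, (⟨s(a, b), hd⟩ : Edge n) ∈ A := by
    intro a b ha hb hd
    by_contra hc
    simp only [S, Finset.mem_filter, Finset.mem_univ, true_and] at ha hb
    have hadj : (graphOf A).Adj a b := ⟨hd, hc⟩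
    exact hb (ha.trans hadj.reachable)
  have hcut : cut S ⊆ A := by
    intro e
    induction e using edge_ind with
    | h a b h =>
      rw [mem_cut]
      rintro (⟨h1, h2⟩ | ⟨h1, h2⟩)
      · exact key a b h1 h2 h
      · have h' : ¬ (s(b, a) : Sym2 (Fin n)).IsDiag := by rwa [Sym2.eq_swap]
        have heq : (⟨s(a, b), h⟩ : Edge n) = ⟨s(b, a), h'⟩ := Subtype.ext Sym2.eq_swap
        rw [heq]; exact key b a h1 h2 h'
  by_cases hS : 2 * S.card ≤ n
  · exact ⟨S, ⟨u, by simp [S]⟩, hS, hcut⟩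
  · refine ⟨Sᶜ, ⟨v, by simpa [S] using huv⟩, ?_, by rwa [cut_compl]⟩
    rw [Finset.card_compl, Fintype.card_fin]; omega

lemma not_connected_of_star_subset {A : Finset (Edge n)} (hn : 2 ≤ n) {v : Fin n}
    (h : star v ⊆ A) : ¬ (graphOf A).Connected := by
  intro hc
  have : Nontrivial (Fin n) := Fin.nontrivial_iff_two_le.2 hn
  obtain ⟨w, hw⟩ := exists_ne v
  obtain ⟨p⟩ := hc.preconnected v w
  cases p with
  | nil => exact hw rfl
  | cons hadj _ =>
    obtain ⟨hd, hA⟩ := hadj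
    exact hA (h ((mem_star hd).2 (Or.inl rfl)))

/-- A disconnected graph without isolated vertices has a component on at most half of the vertices,
and some edge is present inside it. -/
lemma exists_cut_subset_inside {A : Finset (Edge n)} (hn : 0 < n) (h : ¬ (graphOf A).Connected)
    (hiso : ∀ v, ¬ star v ⊆ A) :
    ∃ S : Finset (Fin n), 2 * S.card ≤ n ∧ ∃ e ∈ inside S, cut S ⊆ A ∧ e ∉ A := by
  obtain ⟨S, ⟨v, hv⟩, hS, hcut⟩ := exists_cut_subset hn h
  obtain ⟨e, he, heA⟩ := Finset.not_subset.1 (hiso v)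
  refine ⟨S, hS, e, ?_, hcut, heA⟩
  have hnc : e ∉ cut S := fun hc => heA (hcut hc)
  rw [star, Finset.mem_filter] at he
  simp only [cut, Finset.mem_filter, Finset.mem_univ, true_and, not_and, not_exists] at hnc
  simp only [inside, Finset.mem_filter, Finset.mem_univ, true_and]
  intro w hw
  by_contra hwS
  exact hnc ⟨v, hv, he.2⟩ w hwS hw

end

/-! ### The Poisson limit for the number of isolated vertices -/

open Classical in
/-- The vertices all of whose edges lie in the set `A` of absent edges. -/
noncomputable def isolated {n : ℕ} (A : Finset (Edge n)) : Finset (Fin n) :=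
  Finset.univ.filter fun v => star v ⊆ A

/-- The `r`-th binomial moment of the number of isolated vertices. -/
lemma expect_choose_isolated {n : ℕ} (hn : 2 ≤ n) {α : Edge n → ℝ} (hα : ∀ e, 0 < α e) {p : ℝ}
    (r : ℕ) :
    expect α p (fun A => ((isolated A).card.choose r : ℝ)) =
      ∑ S ∈ Finset.powersetCard r Finset.univ, prob α p fun A => S.biUnion star ⊆ A := by
  classical
  simp only [prob_eq_expect hn hα, ← expect_sum]
  refine congrArg _ (funext fun A => ?_)
  have hiff : ∀ S : Finset (Fin n), S.biUnion star ⊆ A ↔ S ⊆ isolated A := fun S => by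
    simp only [Finset.biUnion_subset, isolated, Finset.subset_iff (s₁ := S), Finset.mem_filter,
      Finset.mem_univ, true_and]
  rw [← Finset.card_powersetCard, Finset.card_eq_sum_ones, Nat.cast_sum, Nat.cast_one,
    ← Finset.sum_subset (Finset.powersetCard_mono (Finset.subset_univ (isolated A)))]
  · refine Finset.sum_congr rfl fun S hS => ?_
    rw [if_pos ((hiff S).2 (Finset.mem_powersetCard.1 hS).1)]
  · intro S hS hS'
    rw [if_neg]
    intro h
    exact hS' (Finset.mem_powersetCard.2 ⟨(hiff S).1 h, (Finset.mem_powersetCard.1 hS).2⟩)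

lemma expect_choose_isolated_one {n : ℕ} (hn : 2 ≤ n) {p : ℝ} (hp : 0 ≤ p) (r : ℕ) :
    expect (fun _ : Edge n => (1 : ℝ)) p (fun A => ((isolated A).card.choose r : ℝ)) =
      n.choose r * max 0 (1 - ((n.choose 2 : ℝ) - (n - r).choose 2) * p / n.choose 2) ^
        n.choose 2 := by
  rw [expect_choose_isolated hn fun _ => one_pos]
  rw [Finset.sum_congr rfl (g := fun _ => max 0 (1 - ((n.choose 2 : ℝ) - (n - r).choose 2) * p /
    n.choose 2) ^ n.choose 2)]
  · simp
  · intro S hS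
    rw [Finset.mem_powersetCard] at hS
    rw [prob_superset hn (fun _ => one_pos) hp, Finset.sum_const, nsmul_eq_mul, mul_one,
      card_biUnion_star, hS.2]

lemma tendsto_log_pow_div (k : ℕ) :
    Tendsto (fun n : ℕ => Real.log n ^ k / n) atTop (𝓝 0) :=
  (Real.isLittleO_pow_log_id_atTop (n := k)).tendsto_div_nhds_zero.comp tendsto_natCast_atTop_atTop

lemma tendsto_log_nat : Tendsto (fun n : ℕ => Real.log n) atTop atTop :=
  Real.tendsto_log_atTop.comp tendsto_natCast_atTop_atTop

lemma neg_div_le_log {x : ℝ} (hx : x < 1) : -(x / (1 - x)) ≤ Real.log (1 - x) := by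
  have h : 0 < 1 - x := by linarith
  have := Real.one_sub_inv_le_log_of_pos h
  have h2 : -(x / (1 - x)) = 1 - (1 - x)⁻¹ := by field_simp; ring
  linarith

/-- A bound for the logarithm of second order, valid for `x` of either sign. -/
lemma neg_sub_le_log {x : ℝ} (hx : x ≤ 1 / 2) : -x - 2 * x ^ 2 ≤ Real.log (1 - x) := by
  refine le_trans ?_ (neg_div_le_log (by linarith))
  rw [neg_sub_left, neg_le_neg_iff, div_le_iff₀ (by linarith)]
  nlinarith [mul_nonneg (sq_nonneg x) (by linarith : 0 ≤ 1 - 2 * x)]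

lemma tendsto_pow_mul_one_sub_pow {x : ℕ → ℝ} {N : ℕ → ℕ} {r : ℕ} {d : ℝ}
    (h0 : Tendsto x atTop (𝓝 0))
    (h1 : Tendsto (fun n => N n * x n - r * Real.log n) atTop (𝓝 d))
    (h2 : Tendsto (fun n => N n * x n ^ 2) atTop (𝓝 0)) :
    Tendsto (fun n : ℕ => (n : ℝ) ^ r * max 0 (1 - x n) ^ N n) atTop (𝓝 (Real.exp (-d))) := by
  have hx : ∀ᶠ n in atTop, x n ≤ 1 / 2 :=
    (h0.eventually_lt_const (by norm_num : (0 : ℝ) < 1 / 2)).mono fun n h => h.le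
  have hlim : Tendsto (fun n : ℕ => r * Real.log n + N n * Real.log (1 - x n)) atTop (𝓝 (-d)) := by
    have hl : Tendsto (fun n => -(N n * x n - r * Real.log n) - 2 * (N n * x n ^ 2)) atTop
        (𝓝 (-d)) := by
      simpa using h1.neg.sub (h2.const_mul 2)
    refine tendsto_of_tendsto_of_tendsto_of_le_of_le' hl h1.neg ?_ ?_
    · filter_upwards [hx] with n hn
      have := mul_le_mul_of_nonneg_left (neg_sub_le_log hn) (Nat.cast_nonneg (α := ℝ) (N n))
      nlinarith
    · filter_upwards [hx] with n hn
      have h3 := Real.log_le_sub_one_of_pos (by linarith : 0 < 1 - x n)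
      have := mul_le_mul_of_nonneg_left h3 (Nat.cast_nonneg (α := ℝ) (N n))
      linarith
  refine ((Real.continuous_exp.tendsto _).comp hlim).congr' ?_
  filter_upwards [hx, eventually_gt_atTop 0] with n hn hn0
  have hn' : (0 : ℝ) < n := by exact_mod_cast hn0
  have hpos : 0 < 1 - x n := by linarith
  rw [max_eq_right hpos.le, Function.comp_apply, Real.exp_add, Real.exp_nat_mul, Real.exp_nat_mul,
    Real.exp_log hn', Real.exp_log hpos]

lemma tendsto_expect_choose_isolated (c : ℝ) (r : ℕ) :
    Tendsto (fun n : ℕ => expect (fun _ : Edge n => (1 : ℝ)) ((Real.log n + c) / n)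
      (fun A => ((isolated A).card.choose r : ℝ))) atTop (𝓝 (Real.exp (-c) ^ r / r.factorial)) := by
  set p : ℕ → ℝ := fun n => (Real.log n + c) / n
  set x : ℕ → ℝ := fun n => ((n.choose 2 : ℝ) - (n - r).choose 2) * p n / n.choose 2
  have hinv : Tendsto (fun n : ℕ => (n : ℝ)⁻¹) atTop (𝓝 0) := tendsto_inv_atTop_nhds_zero_nat
  have hp0 : Tendsto p atTop (𝓝 0) := by
    have := (tendsto_log_pow_div 1).add (hinv.const_mul c)
    simp only [mul_zero, add_zero] at this
    exact this.congr fun n => by simp only [p]; ring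
  have hp2 : Tendsto (fun n : ℕ => p n * (Real.log n + c)) atTop (𝓝 0) := by
    have := ((tendsto_log_pow_div 2).add ((tendsto_log_pow_div 1).const_mul (2 * c))).add
      (hinv.const_mul (c ^ 2))
    simp only [mul_zero, add_zero] at this
    exact this.congr fun n => by simp only [p]; ring
  -- the number of edges touching `r` vertices, divided by `n`
  set s : ℕ → ℝ := fun n => r - r * (r + 1) / 2 * (n : ℝ)⁻¹
  have hs : Tendsto s atTop (𝓝 r) := by
    have := (hinv.const_mul ((r : ℝ) * (r + 1) / 2)).const_sub (r : ℝ)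
    simpa using this
  have ht : Tendsto (fun n : ℕ => (n : ℝ) / n.choose 2) atTop (𝓝 0) := by
    have h : Tendsto (fun n : ℕ => 2 * ((n : ℝ) - 1)⁻¹) atTop (𝓝 0) := by
      have := (tendsto_inv_atTop_zero.comp
        (tendsto_atTop_add_const_right atTop (-1 : ℝ) tendsto_natCast_atTop_atTop)).const_mul 2
      simpa [Function.comp_def, sub_eq_add_neg] using this
    refine h.congr' ?_
    filter_upwards [eventually_ge_atTop 2] with n hn
    have h1 : (2 : ℝ) ≤ n := by exact_mod_cast hn
    have h2 : (n : ℝ) - 1 ≠ 0 := by linarith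
    rw [Nat.cast_choose_two]
    field_simp
  have hNx : ∀ᶠ n : ℕ in atTop, (n.choose 2 : ℝ) * x n = s n * (Real.log n + c) := by
    filter_upwards [eventually_ge_atTop (r + 2)] with n hn
    have h1 : (n : ℝ) ≠ 0 := by
      have : 0 < n := by omega
      positivity
    have h2 := (choose_two_pos (n := n) (by omega)).ne'
    simp only [x, p, s]
    rw [mul_div_cancel₀ _ h2, Nat.cast_choose_two, Nat.cast_choose_two, Nat.cast_sub (by omega)]
    field_simp
    ring
  have hx : ∀ᶠ n : ℕ in atTop, x n = s n * p n * (n / n.choose 2) := by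
    filter_upwards [hNx, eventually_ge_atTop 2] with n hn hn2
    have h1 : (n : ℝ) ≠ 0 := by positivity
    have h2 := (choose_two_pos hn2).ne'
    rw [← mul_right_inj' h2, hn]
    simp only [p]
    field_simp
  have h0 : Tendsto x atTop (𝓝 0) := by
    have := (hs.mul hp0).mul ht
    simp only [mul_zero] at this
    exact this.congr' (hx.mono fun n h => h.symm)
  have h1 : Tendsto (fun n => (n.choose 2 : ℕ) * x n - r * Real.log n) atTop (𝓝 (r * c)) := by
    have := (hp0.const_mul ((r : ℝ) * (r + 1) / 2)).const_sub (r * c)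
    simp only [mul_zero, sub_zero] at this
    refine this.congr' ?_
    filter_upwards [hNx] with n hn
    rw [hn]; simp only [s, p]; ring
  have h2 : Tendsto (fun n => (n.choose 2 : ℕ) * x n ^ 2) atTop (𝓝 0) := by
    have := ((hs.pow 2).mul hp2).mul ht
    simp only [mul_zero] at this
    refine this.congr' ?_
    filter_upwards [hNx, hx] with n hn hn'
    have h : (n.choose 2 : ℝ) * x n ^ 2 = (n.choose 2 * x n) * x n := by ring
    rw [h, hn, hn']; ring
  have hmain := tendsto_pow_mul_one_sub_pow h0 h1 h2
  have hch : Tendsto (fun n : ℕ => (n.choose r : ℝ) * ((n : ℝ)⁻¹) ^ r) atTop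
      (𝓝 (1 ^ r / r.factorial)) := by
    refine ProbabilityTheory.tendsto_choose_mul_pow_atTop r (tendsto_const_nhds.congr' ?_)
    filter_upwards [eventually_gt_atTop 0] with n hn
    have : (n : ℝ) ≠ 0 := by positivity
    field_simp
  have hfin := hch.mul hmain
  have hval : (1 : ℝ) ^ r / r.factorial * Real.exp (-(r * c)) = Real.exp (-c) ^ r / r.factorial := by
    rw [← Real.exp_nat_mul, mul_neg]; ring
  rw [hval] at hfin
  refine hfin.congr' ?_
  have hpnn : ∀ᶠ n : ℕ in atTop, 0 ≤ p n := by
    filter_upwards [tendsto_log_nat.eventually_ge_atTop (-c)] with n hn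
    exact div_nonneg (by linarith) (Nat.cast_nonneg n)
  filter_upwards [hpnn, eventually_ge_atTop 2] with n hpn hn
  have h1 : (n : ℝ) ≠ 0 := by positivity
  rw [expect_choose_isolated_one hn hpn]
  rw [inv_pow]
  field_simp
  simp only [x]

/-- Bonferroni's inequalities, for the counting function of a single point. -/
lemma sum_choose_alternating_le (k R : ℕ) :
    ∑ r ∈ Finset.range (2 * R), (-1 : ℝ) ^ r * k.choose r ≤ if k = 0 then 1 else 0 := by
  rcases k with _ | k
  · rcases R with _ | R
    · simp
    · rw [show 2 * (R + 1) = (2 * R + 1) + 1 by ring, Finset.sum_range_succ']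
      simp
  · rcases R with _ | R
    · simp
    · have h := Int.alternating_sum_range_choose_eq_choose (n := k) (m := 2 * R + 1)
      have h' := congrArg (Int.cast : ℤ → ℝ) h
      push_cast at h'
      rw [show 2 * (R + 1) = (2 * R + 1) + 1 by ring, h', pow_succ, pow_mul]
      simp

lemma le_sum_choose_alternating (k R : ℕ) :
    (if k = 0 then 1 else 0) ≤ ∑ r ∈ Finset.range (2 * R + 1), (-1 : ℝ) ^ r * k.choose r := by
  rcases k with _ | k
  · rw [Finset.sum_range_succ']
    simp
  · have h := Int.alternating_sum_range_choose_eq_choose (n := k) (m := 2 * R)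
    have h' := congrArg (Int.cast : ℤ → ℝ) h
    push_cast at h'
    rw [h', pow_mul]
    simp

/-- A sequence squeezed between alternating partial sums whose terms converge to those of the
exponential series converges to the sum of that series. -/
lemma tendsto_of_bonferroni {P : ℕ → ℝ} {s : ℕ → ℕ → ℝ} {l : ℝ}
    (hs : ∀ r, Tendsto (fun n => s n r) atTop (𝓝 (l ^ r / r.factorial)))
    (hlow : ∀ᶠ n in atTop, ∀ R, ∑ r ∈ Finset.range (2 * R), (-1 : ℝ) ^ r * s n r ≤ P n)
    (hup : ∀ᶠ n in atTop, ∀ R, P n ≤ ∑ r ∈ Finset.range (2 * R + 1), (-1 : ℝ) ^ r * s n r) :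
    Tendsto P atTop (𝓝 (Real.exp (-l))) := by
  have hsum : Tendsto (fun R => ∑ r ∈ Finset.range R, (-1 : ℝ) ^ r * (l ^ r / r.factorial)) atTop
      (𝓝 (Real.exp (-l))) := by
    have h := (NormedSpace.expSeries_div_hasSum_exp (-l)).tendsto_sum_nat
    rw [← Real.exp_eq_exp_ℝ] at h
    refine h.congr fun R => Finset.sum_congr rfl fun r _ => ?_
    rw [neg_pow]; ring
  have hfix : ∀ R, Tendsto (fun n => ∑ r ∈ Finset.range R, (-1 : ℝ) ^ r * s n r) atTop
      (𝓝 (∑ r ∈ Finset.range R, (-1 : ℝ) ^ r * (l ^ r / r.factorial))) :=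
    fun R => tendsto_finsetSum _ fun r _ => (hs r).const_mul _
  have h2 : Tendsto (fun R : ℕ => 2 * R) atTop atTop :=
    tendsto_id.const_mul_atTop' (by norm_num)
  have h3 : Tendsto (fun R : ℕ => 2 * R + 1) atTop atTop := tendsto_atTop_mono (fun _ => Nat.le_succ _) h2
  rw [tendsto_order]
  constructor
  · intro a ha
    obtain ⟨R, hR⟩ := ((hsum.comp h2).eventually_const_lt ha).exists
    filter_upwards [hlow, (hfix (2 * R)).eventually_const_lt hR] with n hn hn'
    exact hn'.trans_le (hn R)
  · intro a ha
    obtain ⟨R, hR⟩ := ((hsum.comp h3).eventually_lt_const ha).exists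
    filter_upwards [hup, (hfix (2 * R + 1)).eventually_lt_const hR] with n hn hn'
    exact (hn R).trans_lt hn'

lemma tendsto_prob_no_isolated (c : ℝ) :
    Tendsto (fun n : ℕ => prob (fun _ : Edge n => (1 : ℝ)) ((Real.log n + c) / n)
      (fun A => ∀ v, ¬ star v ⊆ A)) atTop (𝓝 (Real.exp (-Real.exp (-c)))) := by
  classical
  have key : ∀ n : ℕ, 2 ≤ n → prob (fun _ : Edge n => (1 : ℝ)) ((Real.log n + c) / n)
      (fun A => ∀ v, ¬ star v ⊆ A) = expect (fun _ : Edge n => (1 : ℝ)) ((Real.log n + c) / n)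
      (fun A => if (isolated A).card = 0 then 1 else 0) := by
    intro n hn
    rw [prob_eq_expect hn fun _ => one_pos]
    refine congrArg _ (funext fun A => ?_)
    have h : (∀ v, ¬ star v ⊆ A) ↔ (isolated A).card = 0 := by
      rw [Finset.card_eq_zero, isolated, Finset.filter_eq_empty_iff]
      simp
    by_cases h0 : (isolated A).card = 0
    · rw [if_pos h0, if_pos (h.2 h0)]
    · rw [if_neg h0, if_neg (mt h.1 h0)]
  refine tendsto_of_bonferroni (tendsto_expect_choose_isolated c) ?_ ?_
  · filter_upwards [eventually_ge_atTop 2] with n hn R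
    simp only [key n hn, ← expect_const_mul, ← expect_sum]
    exact expect_mono fun A => sum_choose_alternating_le _ R
  · filter_upwards [eventually_ge_atTop 2] with n hn R
    simp only [key n hn, ← expect_const_mul, ← expect_sum]
    exact expect_mono fun A => le_sum_choose_alternating _ R

/-! ### Union bounds over cuts -/

lemma sum_prod_le_exp {ι : Type*} [Fintype ι] (f : ι → ℝ) (hf : ∀ i, 0 ≤ f i) :
    ∑ S : Finset ι, ∏ i ∈ S, f i ≤ Real.exp (∑ i, f i) := by
  classical
  rw [← Finset.powerset_univ, ← Finset.prod_one_add, Real.exp_sum]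
  refine Finset.prod_le_prod (fun i _ => by linarith [hf i]) fun i _ => ?_
  linarith [Real.add_one_le_exp (f i)]

lemma sum_pow_card_le_exp (n : ℕ) {y : ℝ} (hy : 0 ≤ y) :
    ∑ S : Finset (Fin n), y ^ S.card ≤ Real.exp (n * y) := by
  simpa using sum_prod_le_exp (fun _ : Fin n => y) fun _ => hy

section

variable {n : ℕ} {α : Edge n → ℝ} {p : ℝ}

/-- The union bound over the vertex sets of more than `K` elements. Splitting off the factor
`exp (-(K * (τ - σ)))` leaves a generating function of all vertex sets. -/
lemma sum_large_cut_le (hn : 2 ≤ n) (hα : ∀ e, 0 < α e) (hp : 0 ≤ p) {τ σ K : ℝ} (hστ : σ ≤ τ)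
    (hτ : ∀ S : Finset (Fin n), 2 * S.card ≤ n → τ * S.card ≤ (∑ e ∈ cut S, α e) * p) :
    ∑ S ∈ Finset.univ.filter (fun S : Finset (Fin n) => 2 * S.card ≤ n ∧ K < S.card),
      prob α p (fun A => cut S ⊆ A) ≤ Real.exp (-(K * (τ - σ)) + n * Real.exp (-σ)) := by
  calc _ ≤ ∑ S ∈ Finset.univ.filter (fun S : Finset (Fin n) => 2 * S.card ≤ n ∧ K < S.card),
        Real.exp (-(K * (τ - σ))) * Real.exp (-σ) ^ S.card := by
        refine Finset.sum_le_sum fun S hS => ?_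
        obtain ⟨-, h1, h2⟩ := Finset.mem_filter.1 hS
        refine (prob_superset_le_exp hn hα hp _).trans ?_
        rw [← Real.exp_nat_mul, ← Real.exp_add, Real.exp_le_exp]
        have := hτ S h1
        nlinarith [mul_nonneg (sub_nonneg.2 h2.le) (sub_nonneg.2 hστ)]
    _ ≤ ∑ S : Finset (Fin n), Real.exp (-(K * (τ - σ))) * Real.exp (-σ) ^ S.card :=
        Finset.sum_le_sum_of_subset_of_nonneg (Finset.subset_univ _) fun _ _ _ => by positivity
    _ ≤ _ := by
        rw [← Finset.mul_sum, Real.exp_add]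
        gcongr
        exact sum_pow_card_le_exp n (Real.exp_pos _).le

/-- The union bound over the nonempty vertex sets of at most `K` elements: up to the factor
`exp (K * b * p)` per vertex, the vertices of a small set are isolated independently. -/
lemma sum_small_cut_le (hn : 2 ≤ n) (hα : ∀ e, 0 < α e) (hp : 0 ≤ p) {b K : ℝ} (hb : 0 ≤ b)
    (hαb : ∀ e, α e ≤ b) :
    ∑ S ∈ Finset.univ.filter (fun S : Finset (Fin n) => S.Nonempty ∧ (S.card : ℝ) ≤ K),
      prob α p (fun A => cut S ⊆ A) ≤
        Real.exp (Real.exp (K * b * p) * ∑ v, Real.exp (-(vertexWeight α v * p))) - 1 := by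
  set f : Fin n → ℝ := fun v => Real.exp (K * b * p) * Real.exp (-(vertexWeight α v * p)) with hf
  have hf0 : ∀ v, 0 ≤ f v := fun v => by positivity
  have hsub : Finset.univ.filter (fun S : Finset (Fin n) => S.Nonempty ∧ (S.card : ℝ) ≤ K) ⊆
      Finset.univ.erase ∅ := by
    intro S hS
    have := (Finset.mem_filter.1 hS).2.1
    exact Finset.mem_erase.2 ⟨this.ne_empty, Finset.mem_univ _⟩
  have h1 : ∑ S ∈ Finset.univ.filter (fun S : Finset (Fin n) => S.Nonempty ∧ (S.card : ℝ) ≤ K),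
      prob α p (fun A => cut S ⊆ A) ≤ ∑ S ∈ Finset.univ.erase ∅, ∏ v ∈ S, f v := by
    calc _ ≤ ∑ S ∈ Finset.univ.filter (fun S : Finset (Fin n) => S.Nonempty ∧ (S.card : ℝ) ≤ K),
          ∏ v ∈ S, f v := by
          refine Finset.sum_le_sum fun S hS => ?_
          obtain ⟨-, -, h2⟩ := Finset.mem_filter.1 hS
          refine (prob_superset_le_exp hn hα hp _).trans ?_
          simp only [hf, ← Real.exp_add]
          rw [← Real.exp_sum, Real.exp_le_exp, Finset.sum_add_distrib, Finset.sum_const,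
            nsmul_eq_mul, Finset.sum_neg_distrib, ← Finset.sum_mul]
          have h3 := mul_le_mul_of_nonneg_right (sum_vertexWeight_sub_le_sum_cut hb hαb S) hp
          have h4 : (S.card : ℝ) ^ 2 * b * p ≤ S.card * (K * b * p) := by
            have : 0 ≤ (S.card : ℝ) * (b * p) := by positivity
            nlinarith [mul_le_mul_of_nonneg_right h2 this]
          rw [sub_mul] at h3
          linarith
      _ ≤ _ := Finset.sum_le_sum_of_subset_of_nonneg hsub fun S _ _ =>
          Finset.prod_nonneg fun v _ => hf0 v
  have h2 := sum_prod_le_exp f hf0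
  rw [← Finset.add_sum_erase _ _ (Finset.mem_univ (∅ : Finset (Fin n))), Finset.prod_empty,
    hf, ← Finset.mul_sum] at h2
  linarith

/-- The union bound over the vertex sets of at most `K` elements that contain an edge. -/
lemma sum_small_cut_inside_le (hn : 3 ≤ n) (hp : 0 ≤ p) {K B : ℝ} (hK : K * p ≤ B) :
    ∑ S ∈ Finset.univ.filter (fun S : Finset (Fin n) => (S.card : ℝ) ≤ K),
      ∑ e ∈ inside S, prob (fun _ : Edge n => (1 : ℝ)) p (fun A => cut S ⊆ A ∧ e ∉ A) ≤
        p * Real.exp 1 * Real.exp (n * Real.exp (B + 2 - n * p)) := by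
  calc _ ≤ ∑ S ∈ Finset.univ.filter (fun S : Finset (Fin n) => (S.card : ℝ) ≤ K),
        p * Real.exp 1 * Real.exp (B + 2 - n * p) ^ S.card := by
        refine Finset.sum_le_sum fun S hS => ?_
        have hSK := (Finset.mem_filter.1 hS).2
        have hcut : (S.card : ℝ) * (n - S.card) ≤ ∑ e ∈ cut S, (1 : ℝ) := by
          simpa using le_sum_cut (α := fun _ : Edge n => (1 : ℝ)) (fun _ => le_rfl) S
        have hcard : ((inside S).card : ℝ) ≤ Real.exp (2 * S.card) := by
          have h1 : (S.card : ℝ) ≤ Real.exp S.card := by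
            linarith [Real.add_one_le_exp (S.card : ℝ)]
          rw [card_inside, Nat.cast_choose_two, two_mul, Real.exp_add]
          have h0 : (0 : ℝ) ≤ S.card := Nat.cast_nonneg _
          nlinarith [mul_le_mul h1 h1 h0 (Real.exp_pos _).le]
        have hterm : ∀ e ∈ inside S,
            prob (fun _ : Edge n => (1 : ℝ)) p (fun A => cut S ⊆ A ∧ e ∉ A) ≤
              p * Real.exp 1 * Real.exp (S.card * (B - n * p)) := by
          intro e he
          have hec : e ∉ cut S := by
            simp only [inside, cut, Finset.mem_filter, Finset.mem_univ, true_and, not_and,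
              not_exists] at he ⊢
            exact fun _ w hw hwe => hw (he w hwe)
          refine (prob_superset_present_le hn (fun _ => one_pos) hp _ hec).trans ?_
          rw [one_mul]
          gcongr
          have h1 := mul_le_mul_of_nonneg_right hcut hp
          have h2 : (S.card : ℝ) * (S.card * p) ≤ S.card * B := by
            gcongr
            exact (mul_le_mul_of_nonneg_right hSK hp).trans hK
          nlinarith
        calc _ ≤ ∑ _e ∈ inside S, p * Real.exp 1 * Real.exp (S.card * (B - n * p)) :=
              Finset.sum_le_sum hterm
          _ = (inside S).card * (p * Real.exp 1 * Real.exp (S.card * (B - n * p))) := by simp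
          _ ≤ Real.exp (2 * S.card) * (p * Real.exp 1 * Real.exp (S.card * (B - n * p))) := by
              gcongr
          _ = p * Real.exp 1 * (Real.exp (2 * S.card) * Real.exp (S.card * (B - n * p))) := by ring
          _ = _ := by
              rw [← Real.exp_add, ← Real.exp_nat_mul]; congr 2; ring
    _ ≤ ∑ S : Finset (Fin n), p * Real.exp 1 * Real.exp (B + 2 - n * p) ^ S.card :=
        Finset.sum_le_sum_of_subset_of_nonneg (Finset.subset_univ _) fun _ _ _ => by positivity
    _ ≤ _ := by
        rw [← Finset.mul_sum]
        gcongr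
        exact sum_pow_card_le_exp n (Real.exp_pos _).le

lemma prob_not_connected_le (hn : 2 ≤ n) (hα : ∀ e, 0 < α e) (K : ℝ) :
    1 - probConnected n α p ≤
      ∑ S ∈ Finset.univ.filter (fun S : Finset (Fin n) => S.Nonempty ∧ (S.card : ℝ) ≤ K),
        prob α p (fun A => cut S ⊆ A) +
      ∑ S ∈ Finset.univ.filter (fun S : Finset (Fin n) => 2 * S.card ≤ n ∧ K < S.card),
        prob α p (fun A => cut S ⊆ A) := by
  classical
  rw [probConnected_eq, ← prob_not hn hα, ← Finset.sum_union]
  · refine prob_le_sum hn hα _ fun A hA => ?_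
    obtain ⟨S, hS, h2, hc⟩ := exists_cut_subset (by omega) hA
    refine ⟨S, ?_, hc⟩
    simp only [Finset.mem_union, Finset.mem_filter, Finset.mem_univ, true_and]
    rcases le_or_gt (S.card : ℝ) K with h | h
    exacts [Or.inl ⟨hS, h⟩, Or.inr ⟨h2, h⟩]
  · refine Finset.disjoint_left.2 fun S h1 h2 => ?_
    exact absurd (Finset.mem_filter.1 h1).2.2 (not_le.2 (Finset.mem_filter.1 h2).2.2)

lemma prob_not_connected_no_isolated_le (hn : 2 ≤ n) (hα : ∀ e, 0 < α e) (K : ℝ) :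
    prob α p (fun A => (∀ v, ¬ star v ⊆ A) ∧ ¬ (graphOf A).Connected) ≤
      ∑ S ∈ Finset.univ.filter (fun S : Finset (Fin n) => (S.card : ℝ) ≤ K),
        ∑ e ∈ inside S, prob α p (fun A => cut S ⊆ A ∧ e ∉ A) +
      ∑ S ∈ Finset.univ.filter (fun S : Finset (Fin n) => 2 * S.card ≤ n ∧ K < S.card),
        prob α p (fun A => cut S ⊆ A) := by
  classical
  have h := prob_le_sum (p := p) hn hα
    (Finset.univ.filter (fun S : Finset (Fin n) => (S.card : ℝ) ≤ K) ∪
      Finset.univ.filter (fun S : Finset (Fin n) => 2 * S.card ≤ n ∧ K < S.card))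
    (Q := fun A => (∀ v, ¬ star v ⊆ A) ∧ ¬ (graphOf A).Connected)
    (R := fun S A => cut S ⊆ A ∧ ((S.card : ℝ) ≤ K → ∃ e ∈ inside S, cut S ⊆ A ∧ e ∉ A)) ?_
  · refine h.trans ?_
    rw [Finset.sum_union]
    · refine add_le_add (Finset.sum_le_sum fun S hS => ?_) (Finset.sum_le_sum fun S hS => ?_)
      · exact prob_le_sum hn hα _ fun A hA => hA.2 (Finset.mem_filter.1 hS).2
      · exact prob_mono hn hα fun A hA => hA.1
    · refine Finset.disjoint_left.2 fun S h1 h2 => ?_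
      exact absurd (Finset.mem_filter.1 h1).2 (not_le.2 (Finset.mem_filter.1 h2).2.2)
  · rintro A ⟨h1, h2⟩
    obtain ⟨S, hS, e, he, hc, heA⟩ := exists_cut_subset_inside (by omega) h2 h1
    refine ⟨S, ?_, hc, fun _ => ⟨e, he, hc, heA⟩⟩
    simp only [Finset.mem_union, Finset.mem_filter, Finset.mem_univ, true_and]
    rcases le_or_gt (S.card : ℝ) K with h | h
    exacts [Or.inl h, Or.inr ⟨hS, h⟩]

end

/-! ### Large cuts are negligible -/

lemma tendsto_mul_sqrt_sub_log {c : ℝ} (hc : 0 < c) :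
    Tendsto (fun x : ℝ => c * √x - Real.log x) atTop atTop := by
  have h1 : Tendsto (fun x : ℝ => √x) atTop atTop := Real.tendsto_sqrt_atTop
  have h2 : Tendsto (fun y : ℝ => y * (c - 2 * (Real.log y / y))) atTop atTop := by
    have h := (Real.isLittleO_log_id_atTop.tendsto_div_nhds_zero.const_mul 2).const_sub c
    simp only [mul_zero, sub_zero, id] at h
    exact tendsto_id.atTop_mul_pos hc h
  refine (h2.comp h1).congr' ?_
  filter_upwards [eventually_gt_atTop 0] with x hx
  have h0 : 0 < √x := Real.sqrt_pos.2 hx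
  have : Real.log x = 2 * Real.log (√x) := by
    rw [Real.log_sqrt hx.le]; ring
  rw [this, Function.comp_apply]
  field_simp

lemma tendsto_large_cut_bound {κ c : ℝ} (hκ : 0 < κ) (hc : 0 < c) :
    Tendsto (fun n : ℕ => Real.exp (-(κ * n / Real.log n *
      (c * √(Real.log n) - Real.log (Real.log n))) + n * Real.exp (-Real.log (Real.log n))))
      atTop (𝓝 0) := by
  refine Real.tendsto_exp_atBot.comp ?_
  have h1 : Tendsto (fun n : ℕ => (n : ℝ) / Real.log n) atTop atTop := by
    have h : Tendsto (fun n : ℕ => Real.log n ^ 1 / n) atTop (𝓝[>] 0) := by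
      refine tendsto_nhdsWithin_iff.2 ⟨tendsto_log_pow_div 1, ?_⟩
      filter_upwards [tendsto_log_nat.eventually_gt_atTop 0, eventually_gt_atTop 0] with n hn hn0
      have : (0 : ℝ) < n := by exact_mod_cast hn0
      exact div_pos (pow_pos hn 1) this
    refine h.inv_tendsto_nhdsGT_zero.congr fun n => ?_
    rw [Pi.inv_apply, inv_div, pow_one]
  have h2 : Tendsto (fun n : ℕ => κ * (c * √(Real.log n) - Real.log (Real.log n)) - 1)
      atTop atTop :=
    tendsto_atTop_add_const_right _ _
      (((tendsto_mul_sqrt_sub_log hc).comp tendsto_log_nat).const_mul_atTop hκ)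
  refine (tendsto_neg_atTop_atBot.comp (h1.atTop_mul_atTop₀ h2)).congr' ?_
  filter_upwards [tendsto_log_nat.eventually_gt_atTop 0] with n hn
  rw [Function.comp_apply, Real.exp_neg, Real.exp_log hn]
  field_simp
  ring

lemma tendsto_sum_large_cut {α : (n : ℕ) → Edge n → ℝ} {p : ℕ → ℝ} {κ c : ℝ}
    (hα : ∀ n e, 0 < α n e) (hp : ∀ᶠ n in atTop, 0 ≤ p n) (hκ : 0 < κ) (hc : 0 < c)
    (hτ : ∀ᶠ n : ℕ in atTop, ∀ S : Finset (Fin n), 2 * S.card ≤ n →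
      c * √(Real.log n) * S.card ≤ (∑ e ∈ cut S, α n e) * p n) :
    Tendsto (fun n : ℕ =>
      ∑ S ∈ Finset.univ.filter
        (fun S : Finset (Fin n) => 2 * S.card ≤ n ∧ κ * n / Real.log n < S.card),
      prob (α n) (p n) (fun A => cut S ⊆ A)) atTop (𝓝 0) := by
  refine tendsto_of_tendsto_of_tendsto_of_le_of_le' tendsto_const_nhds
    (tendsto_large_cut_bound hκ hc)
    (Eventually.of_forall fun n => Finset.sum_nonneg fun S _ => prob_nonneg _) ?_
  filter_upwards [hp, hτ, eventually_ge_atTop 2,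
    ((tendsto_mul_sqrt_sub_log hc).comp tendsto_log_nat).eventually_ge_atTop 0] with n h1 h2 h3 h4
  exact sum_large_cut_le h3 (hα n) h1 (sub_nonneg.1 h4) h2

/-! ### The threshold for equal coefficients -/

lemma tendsto_log_add_div (c : ℝ) :
    Tendsto (fun n : ℕ => (Real.log n + c) / n) atTop (𝓝 0) := by
  have := (tendsto_log_pow_div 1).add (tendsto_inv_atTop_nhds_zero_nat.const_mul c)
  simp only [mul_zero, add_zero] at this
  exact this.congr fun n => by ring

lemma eventually_log_add_div_nonneg (c : ℝ) : ∀ᶠ n : ℕ in atTop, 0 ≤ (Real.log n + c) / n := by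
  filter_upwards [tendsto_log_nat.eventually_ge_atTop (-c)] with n hn
  exact div_nonneg (by linarith) (Nat.cast_nonneg n)

/-- In the threshold window, isolated vertices are the only obstruction to connectivity. -/
lemma tendsto_prob_not_connected_no_isolated (c : ℝ) :
    Tendsto (fun n : ℕ => prob (fun _ : Edge n => (1 : ℝ)) ((Real.log n + c) / n)
      (fun A => (∀ v, ¬ star v ⊆ A) ∧ ¬ (graphOf A).Connected)) atTop (𝓝 0) := by
  have hp0 := eventually_log_add_div_nonneg c
  have hlarge := tendsto_sum_large_cut (α := fun n _ => (1 : ℝ)) (c := 1 / 4) (κ := 1)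
    (fun _ _ => one_pos) hp0 one_pos (by norm_num) (by
      filter_upwards [tendsto_log_nat.eventually_ge_atTop (1 : ℝ),
        tendsto_log_nat.eventually_ge_atTop (2 * |c|), eventually_gt_atTop 0, hp0]
        with n h1 h2 h3 h4 S hS
      have hn : (0 : ℝ) < n := by exact_mod_cast h3
      have hcut : (S.card : ℝ) * (n - S.card) ≤ ∑ e ∈ cut S, (1 : ℝ) := by
        simpa using le_sum_cut (α := fun _ : Edge n => (1 : ℝ)) (fun _ => le_rfl) S
      have hS' : 2 * (S.card : ℝ) ≤ n := by exact_mod_cast hS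
      have hsq : √(Real.log n) ≤ Real.log n := by
        rw [Real.sqrt_le_left (by linarith)]; nlinarith
      have habs := neg_abs_le c
      have hSn : (0 : ℝ) ≤ S.card := Nat.cast_nonneg _
      calc 1 / 4 * √(Real.log n) * S.card ≤ S.card * ((Real.log n + c) / 2) := by
            nlinarith
        _ = (S.card : ℝ) * (n / 2) * ((Real.log n + c) / n) := by field_simp
        _ ≤ (S.card : ℝ) * (n - S.card) * ((Real.log n + c) / n) := by
            gcongr
            linarith
        _ ≤ _ := mul_le_mul_of_nonneg_right hcut h4)
  have hsmall : Tendsto (fun n : ℕ => (Real.log n + c) / n * Real.exp 1 *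
      Real.exp (Real.exp (4 - c))) atTop (𝓝 0) := by
    have := ((tendsto_log_add_div c).mul_const (Real.exp 1)).mul_const (Real.exp (Real.exp (4 - c)))
    simpa using this
  have hsum := hsmall.add hlarge
  rw [add_zero] at hsum
  refine tendsto_of_tendsto_of_tendsto_of_le_of_le' tendsto_const_nhds hsum
    (Eventually.of_forall fun n => prob_nonneg _) ?_
  filter_upwards [hp0, eventually_ge_atTop 3, tendsto_log_nat.eventually_ge_atTop (1 : ℝ),
        tendsto_log_nat.eventually_ge_atTop |c|] with n h1 h2 h3 h4
  refine (prob_not_connected_no_isolated_le (by omega) (fun _ => one_pos)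
    (1 * n / Real.log n)).trans (add_le_add ?_ le_rfl)
  have hn : (n : ℝ) ≠ 0 := by positivity
  have hK : 1 * n / Real.log n * ((Real.log n + c) / n) ≤ 2 := by
    have : 1 * n / Real.log n * ((Real.log n + c) / n) = (Real.log n + c) / Real.log n := by
      field_simp
    rw [this, div_le_iff₀ (by linarith)]
    linarith [le_abs_self c]
  refine (sum_small_cut_inside_le h2 h1 hK).trans (le_of_eq ?_)
  congr 2
  have : (2 : ℝ) + 2 - n * ((Real.log n + c) / n) = (4 - c) + -Real.log n := by
    field_simp; ring
  rw [this, Real.exp_add, Real.exp_neg, Real.exp_log (by positivity)]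
  field_simp

lemma tendsto_probConnected_one_const (c : ℝ) :
    Tendsto (fun n : ℕ => probConnected n (fun _ => 1) ((Real.log n + c) / n)) atTop
      (𝓝 (Real.exp (-Real.exp (-c)))) := by
  have h := (tendsto_prob_no_isolated c).sub (tendsto_prob_not_connected_no_isolated c)
  rw [sub_zero] at h
  refine h.congr' ?_
  filter_upwards [eventually_ge_atTop 2] with n hn
  rw [probConnected_eq, sub_eq_iff_eq_add,
    ← prob_and_add hn (fun _ => one_pos) _ fun A => (graphOf A).Connected]
  congr 2
  ext A
  exact and_iff_right_of_imp fun hA v hv => not_connected_of_star_subset hn hv hA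

lemma probConnected_one_le {n : ℕ} (hn : 2 ≤ n) {a b : ℝ} (hab : a ≤ b) :
    probConnected n (fun _ => 1) ((Real.log n + a) / n) ≤
      probConnected n (fun _ => 1) ((Real.log n + b) / n) :=
  probConnected_mono hn (fun _ => one_pos) (by gcongr)

lemma tendsto_double_exp_atBot : Tendsto (fun c : ℝ => Real.exp (-Real.exp (-c))) atBot (𝓝 0) :=
  Real.tendsto_exp_atBot.comp
    (tendsto_neg_atTop_atBot.comp (Real.tendsto_exp_atTop.comp tendsto_neg_atBot_atTop))

lemma tendsto_double_exp_atTop : Tendsto (fun c : ℝ => Real.exp (-Real.exp (-c))) atTop (𝓝 1) := by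
  have h := (Real.tendsto_exp_atBot.comp tendsto_neg_atTop_atBot).neg
  have h2 := (Real.continuous_exp.tendsto (-0)).comp h
  simpa [Function.comp_def] using h2

/-- Monotonicity in `c` reduces a varying `c n` to constants. -/
lemma eventually_probConnected_one_lt {c : ℕ → ℝ} {b a : ℝ} (hc : ∀ᶠ n in atTop, c n ≤ b)
    (ha : Real.exp (-Real.exp (-b)) < a) :
    ∀ᶠ n : ℕ in atTop, probConnected n (fun _ => 1) ((Real.log n + c n) / n) < a := by
  filter_upwards [hc, (tendsto_probConnected_one_const b).eventually_lt_const ha,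
    eventually_ge_atTop 2] with n h1 h2 h3
  exact (probConnected_one_le h3 h1).trans_lt h2

lemma eventually_lt_probConnected_one {c : ℕ → ℝ} {b a : ℝ} (hc : ∀ᶠ n in atTop, b ≤ c n)
    (ha : a < Real.exp (-Real.exp (-b))) :
    ∀ᶠ n : ℕ in atTop, a < probConnected n (fun _ => 1) ((Real.log n + c n) / n) := by
  filter_upwards [hc, (tendsto_probConnected_one_const b).eventually_const_lt ha,
    eventually_ge_atTop 2] with n h1 h2 h3
  exact h2.trans_le (probConnected_one_le h3 h1)

lemma tendsto_probConnected_one_atBot {c : ℕ → ℝ} (hc : Tendsto c atTop atBot) :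
    Tendsto (fun n : ℕ => probConnected n (fun _ => 1) ((Real.log n + c n) / n)) atTop (𝓝 0) := by
  refine tendsto_order.2 ⟨fun a ha => Eventually.of_forall fun n =>
    ha.trans_le probConnected_nonneg, fun a ha => ?_⟩
  obtain ⟨b, hb⟩ := (tendsto_double_exp_atBot.eventually_lt_const ha).exists
  exact eventually_probConnected_one_lt (hc.eventually_le_atBot b) hb

lemma tendsto_probConnected_one_atTop {c : ℕ → ℝ} (hc : Tendsto c atTop atTop) :
    Tendsto (fun n : ℕ => probConnected n (fun _ => 1) ((Real.log n + c n) / n)) atTop (𝓝 1) := by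
  refine tendsto_order.2 ⟨fun a ha => ?_, fun a ha => ?_⟩
  · obtain ⟨b, hb⟩ := (tendsto_double_exp_atTop.eventually_const_lt ha).exists
    exact eventually_lt_probConnected_one (hc.eventually_ge_atTop b) hb
  · filter_upwards [eventually_ge_atTop 2] with n hn
    exact (probConnected_le_one hn fun _ => one_pos).trans_lt ha

lemma tendsto_probConnected_one_nhds {c : ℕ → ℝ} {c' : ℝ} (hc : Tendsto c atTop (𝓝 c')) :
    Tendsto (fun n : ℕ => probConnected n (fun _ => 1) ((Real.log n + c n) / n)) atTop
      (𝓝 (Real.exp (-Real.exp (-c')))) := by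
  have hcont : Continuous fun c : ℝ => Real.exp (-Real.exp (-c)) := by fun_prop
  refine tendsto_order.2 ⟨fun a ha => ?_, fun a ha => ?_⟩
  · have h := (hcont.tendsto c').mono_left (nhdsWithin_le_nhds (s := Set.Iio c'))
    obtain ⟨b, hb, hbc⟩ := ((h.eventually_const_lt ha).and self_mem_nhdsWithin).exists
    exact eventually_lt_probConnected_one
      ((hc.eventually_const_lt (show b < c' from hbc)).mono fun _ h => h.le) hb
  · have h := (hcont.tendsto c').mono_left (nhdsWithin_le_nhds (s := Set.Ioi c'))
    obtain ⟨b, hb, hbc⟩ := ((h.eventually_lt_const ha).and self_mem_nhdsWithin).exists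
    exact eventually_probConnected_one_lt
      ((hc.eventually_lt_const (show c' < b from hbc)).mono fun _ h => h.le) hb

/-! ### The critical value for bounded coefficients -/

/-- The inequalities used at a fixed `n`: the bounds on the coefficients, and `n` large enough
for `Real.log n` to be at least `2` and small compared to the number of edges. -/
structure Admissible {n : ℕ} (M : ℝ) (α : Edge n → ℝ) : Prop where
  three_le : 3 ≤ n
  two_le_log : 2 ≤ Real.log n
  log_pow_le : Real.log n ^ 4 ≤ n.choose 2
  pos : ∀ e, 0 < α e
  lower : ∀ e, 1 / M ≤ α e
  upper : ∀ e, α e ≤ M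
  one_le : 1 ≤ M
  sq_le : M ^ 2 ≤ √(Real.log n)

lemma eventually_log_pow_le : ∀ᶠ n : ℕ in atTop, Real.log n ^ 4 ≤ n.choose 2 := by
  filter_upwards [(tendsto_log_pow_div 4).eventually_lt_const one_pos, eventually_ge_atTop 3]
    with n h hn
  have hn' : (3 : ℝ) ≤ n := by exact_mod_cast hn
  rw [div_lt_one (by linarith)] at h
  rw [Nat.cast_choose_two]
  nlinarith

lemma eventually_admissible {α : (n : ℕ) → Edge n → ℝ} {M : ℕ → ℝ} (hα : ∀ n e, 0 < α n e)
    (hM : ∀ᶠ n : ℕ in atTop, MBounded (M n) (α n) ∧ M n ≤ Real.log n ^ ((1 : ℝ) / 4)) :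
    ∀ᶠ n in atTop, Admissible (M n) (α n) := by
  filter_upwards [hM, eventually_ge_atTop 3, tendsto_log_nat.eventually_ge_atTop 2,
    eventually_log_pow_le] with n h1 h2 h3 h4
  have hc : 0 < Fintype.card (Edge n) := by rw [card_edge]; exact Nat.choose_pos (by omega)
  obtain ⟨e⟩ := Fintype.card_pos_iff.1 hc
  have hMpos : 0 < M n := (hα n e).trans_le (h1.1 e).2
  have hMone : 1 ≤ M n := by
    have h := (h1.1 e).1.trans (h1.1 e).2
    rw [div_le_iff₀ hMpos] at h
    nlinarith
  refine ⟨h2, h3, h4, hα n, fun e => (h1.1 e).1, fun e => (h1.1 e).2, hMone, ?_⟩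
  calc M n ^ 2 ≤ (Real.log n ^ ((1 : ℝ) / 4)) ^ 2 := by gcongr; exact h1.2
    _ = √(Real.log n) := by
      rw [← Real.rpow_natCast, ← Real.rpow_mul (by linarith), Real.sqrt_eq_rpow]; norm_num

section

variable {n : ℕ} {α : Edge n → ℝ} {M : ℝ}

namespace Admissible

lemma cast_ge (h : Admissible M α) : (3 : ℝ) ≤ n := by exact_mod_cast h.three_le

lemma choose_pos (h : Admissible M α) : 0 < (n.choose 2 : ℝ) :=
  choose_two_pos (by have := h.three_le; omega)

lemma sqrt_le (h : Admissible M α) : √(Real.log n) ≤ Real.log n := by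
  have := h.two_le_log
  rw [Real.sqrt_le_left (by linarith)]; nlinarith

lemma le_vertexWeight (h : Admissible M α) (v : Fin n) :
    ((n : ℝ) - 1) / M ≤ vertexWeight α v := by
  have := SimplexGraph.le_vertexWeight h.lower v
  rwa [mul_one_div] at this

lemma vertexWeight_pos (h : Admissible M α) (v : Fin n) : 0 < vertexWeight α v :=
  (div_pos (by linarith [h.cast_ge]) (by linarith [h.one_le])).trans_le (h.le_vertexWeight v)

lemma vertexWeight_le (h : Admissible M α) (v : Fin n) :
    vertexWeight α v ≤ ((n : ℝ) - 1) * M :=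
  SimplexGraph.vertexWeight_le (by linarith [h.one_le]) h.upper v

end Admissible

lemma xi_le_exp {p : ℝ} (hn : 2 ≤ n) {v : Fin n} (h : vertexWeight α v * p ≤ n.choose 2) :
    xi α p v ≤ Real.exp (-(vertexWeight α v * p)) := by
  have hN := choose_two_pos hn
  have hy : vertexWeight α v * p / n.choose 2 ≤ 1 := by rwa [div_le_one hN]
  calc xi α p v ≤ Real.exp (-(vertexWeight α v * p / n.choose 2)) ^ n.choose 2 := by
        refine pow_le_pow_left₀ (by linarith) ?_ _
        linarith [Real.add_one_le_exp (-(vertexWeight α v * p / n.choose 2))]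
    _ = _ := by rw [← Real.exp_nat_mul]; congr 1; field_simp

lemma sum_xi_strictAntiOn (h : Admissible M α) {p q : ℝ} (hpq : p < q)
    (hq : ∀ v, vertexWeight α v * q ≤ n.choose 2) : ∑ v, xi α q v < ∑ v, xi α p v := by
  have hN := h.choose_pos
  have hn : 0 < n := by have := h.three_le; omega
  refine Finset.sum_lt_sum_of_nonempty ⟨⟨0, hn⟩, Finset.mem_univ _⟩ fun v _ => ?_
  have h1 : vertexWeight α v * q / n.choose 2 ≤ 1 := by rw [div_le_one hN]; exact hq v
  have h2 : vertexWeight α v * p / n.choose 2 < vertexWeight α v * q / n.choose 2 := by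
    have := h.vertexWeight_pos v
    gcongr
  exact pow_lt_pow_left₀ (by linarith) (by linarith)
    (Nat.choose_pos (by have := h.three_le; omega)).ne'

lemma existsUnique_isCritical (h : Admissible M α) : ∃! q : ℝ, IsCritical α q := by
  have hN := h.choose_pos
  have hn3 := h.cast_ge
  have hn : 0 < n := by have := h.three_le; omega
  have hM := h.one_le
  obtain ⟨v₀, -, hv₀⟩ := Finset.exists_max_image (Finset.univ : Finset (Fin n)) (vertexWeight α)
    ⟨⟨0, hn⟩, Finset.mem_univ _⟩
  have hw₀ := h.vertexWeight_pos v₀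
  set T : ℝ := n.choose 2 / vertexWeight α v₀ with hT
  have hT0 : 0 ≤ T := (div_pos hN hw₀).le
  have hrange : ∀ q, q ≤ T → 0 ≤ q → ∀ v, vertexWeight α v * q ≤ n.choose 2 := by
    intro q hq hq0 v
    calc vertexWeight α v * q ≤ vertexWeight α v₀ * T := by
          have := hv₀ v (Finset.mem_univ v)
          gcongr
      _ = n.choose 2 := by rw [hT]; field_simp
  have hcont : ContinuousOn (fun q => ∑ v, xi α q v) (Set.Icc 0 T) := by
    unfold xi; fun_prop
  have h0 : (1 : ℝ) ≤ ∑ v, xi α 0 v := by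
    simp only [xi, mul_zero, zero_div, sub_zero, one_pow, Finset.sum_const, Finset.card_univ,
      Fintype.card_fin, nsmul_eq_mul, mul_one]
    linarith
  have h1 : ∑ v, xi α T v ≤ 1 := by
    have hlog : Real.log n ≤ n.choose 2 / M ^ 2 := by
      rw [le_div_iff₀ (by positivity)]
      have h1 := h.two_le_log
      have h2 := h.sq_le.trans h.sqrt_le
      have h3 := h.log_pow_le
      have h4 : Real.log n * Real.log n ≤ Real.log n ^ 4 := by
        rw [← sq]; exact pow_le_pow_right₀ (by linarith) (by norm_num)
      nlinarith
    calc ∑ v, xi α T v ≤ ∑ _v : Fin n, Real.exp (-Real.log n) := by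
          refine Finset.sum_le_sum fun v _ => ?_
          refine (xi_le_exp (by have := h.three_le; omega) (hrange T le_rfl hT0 v)).trans ?_
          rw [Real.exp_le_exp, neg_le_neg_iff]
          refine hlog.trans ?_
          have h1 := h.le_vertexWeight v
          have h2 := h.vertexWeight_le v₀
          rw [hT, mul_div_assoc', div_le_div_iff₀ (by positivity) hw₀]
          have h3 : vertexWeight α v₀ ≤ vertexWeight α v * M ^ 2 := by
            rw [div_le_iff₀ (by linarith)] at h1
            nlinarith
          nlinarith
      _ = 1 := by
          rw [Real.exp_neg, Real.exp_log (by linarith)]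
          simp
          field_simp
  obtain ⟨q, hq, hq1⟩ := intermediate_value_Icc' hT0 hcont ⟨h1, h0⟩
  refine ⟨q, ⟨hq.1, hrange q hq.2 hq.1, hq1⟩, ?_⟩
  rintro q' ⟨-, hr, hs⟩
  rcases lt_trichotomy q' q with hlt | heq | hlt
  · have := sum_xi_strictAntiOn h hlt (hrange q hq.2 hq.1)
    simp only at hq1
    linarith
  · exact heq
  · have := sum_xi_strictAntiOn h hlt hr
    simp only at hq1
    linarith

/-! ### The size of the critical value -/

namespace Admissible

variable {p₀ : ℝ}

lemma critical_upper (h : Admissible M α) (hp : IsCritical α p₀) :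
    ((n : ℝ) - 1) * p₀ ≤ M * Real.log n := by
  obtain ⟨h0, hr, hs⟩ := hp
  have hM := h.one_le
  have hn3 := h.cast_ge
  have h1 : (1 : ℝ) ≤ n * Real.exp (-(((n : ℝ) - 1) / M * p₀)) := by
    calc (1 : ℝ) = ∑ v, xi α p₀ v := hs.symm
      _ ≤ ∑ _v : Fin n, Real.exp (-(((n : ℝ) - 1) / M * p₀)) := by
          refine Finset.sum_le_sum fun v _ => ?_
          refine (xi_le_exp (by have := h.three_le; omega) (hr v)).trans ?_
          rw [Real.exp_le_exp, neg_le_neg_iff]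
          exact mul_le_mul_of_nonneg_right (h.le_vertexWeight v) h0
      _ = _ := by simp
  have h2 := Real.log_le_log one_pos h1
  rw [Real.log_one, Real.log_mul (by linarith) (Real.exp_pos _).ne', Real.log_exp] at h2
  have h3 : ((n : ℝ) - 1) * p₀ = M * (((n : ℝ) - 1) / M * p₀) := by field_simp
  rw [h3]
  gcongr
  linarith

lemma vertexWeight_mul_le (h : Admissible M α) (hp : IsCritical α p₀) (v : Fin n) :
    vertexWeight α v * p₀ ≤ Real.log n * √(Real.log n) := by
  have hM := h.one_le
  have h1 := h.two_le_log
  calc vertexWeight α v * p₀ ≤ ((n : ℝ) - 1) * M * p₀ :=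
        mul_le_mul_of_nonneg_right (h.vertexWeight_le v) hp.1
    _ = M * (((n : ℝ) - 1) * p₀) := by ring
    _ ≤ M * (M * Real.log n) :=
        mul_le_mul_of_nonneg_left (h.critical_upper hp) (by linarith)
    _ = Real.log n * M ^ 2 := by ring
    _ ≤ _ := by gcongr; exact h.sq_le

lemma sq_vertexWeight_mul_le (h : Admissible M α) (hp : IsCritical α p₀) (v : Fin n) :
    (vertexWeight α v * p₀) ^ 2 ≤ n.choose 2 := by
  have h1 := h.two_le_log
  calc (vertexWeight α v * p₀) ^ 2 ≤ (Real.log n * √(Real.log n)) ^ 2 :=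
        pow_le_pow_left₀ (mul_nonneg (h.vertexWeight_pos v).le hp.1) (h.vertexWeight_mul_le hp v) 2
    _ = Real.log n ^ 3 := by rw [mul_pow, Real.sq_sqrt (by linarith)]; ring
    _ ≤ Real.log n ^ 4 := pow_le_pow_right₀ (by linarith) (by norm_num)
    _ ≤ _ := h.log_pow_le

lemma vertexWeight_mul_div_le (h : Admissible M α) (hp : IsCritical α p₀) (v : Fin n) :
    vertexWeight α v * p₀ / n.choose 2 ≤ 1 / 2 := by
  rw [div_le_iff₀ h.choose_pos]
  have h1 := h.two_le_log
  have h2 := h.vertexWeight_mul_le hp v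
  have h3 : Real.log n * √(Real.log n) ≤ Real.log n * Real.log n := by
    gcongr; exact h.sqrt_le
  have h4 := h.log_pow_le
  have h5 : (4 : ℝ) ≤ Real.log n ^ 2 := by nlinarith
  nlinarith

lemma critical_lower (h : Admissible M α) (hp : IsCritical α p₀) :
    Real.log n ≤ 2 * (((n : ℝ) - 1) * M * p₀) := by
  by_contra! hc
  have hN := h.choose_pos
  have hn3 := h.cast_ge
  have hs := hp.2.2
  have hlt : ∑ _v : Fin n, Real.exp (-Real.log n) < ∑ v, xi α p₀ v := by
    refine Finset.sum_lt_sum_of_nonempty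
      ⟨⟨0, by have := h.three_le; omega⟩, Finset.mem_univ _⟩ fun v _ => ?_
    set y := vertexWeight α v * p₀ / n.choose 2 with hy
    have hy0 : 0 ≤ y := div_nonneg (mul_nonneg (h.vertexWeight_pos v).le hp.1) hN.le
    have hy1 : y ≤ 1 / 2 := h.vertexWeight_mul_div_le hp v
    have h1 : Real.exp (-(2 * y)) ≤ 1 - y := by
      rw [← Real.le_log_iff_exp_le (by linarith)]
      have := neg_sub_le_log hy1
      nlinarith
    calc Real.exp (-Real.log n) < Real.exp (-(2 * (vertexWeight α v * p₀))) := by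
          rw [Real.exp_lt_exp, neg_lt_neg_iff]
          have := mul_le_mul_of_nonneg_right (h.vertexWeight_le v) hp.1
          linarith
      _ = Real.exp (-(2 * y)) ^ n.choose 2 := by
          rw [← Real.exp_nat_mul, hy]; congr 1; field_simp
      _ ≤ (1 - y) ^ n.choose 2 := pow_le_pow_left₀ (Real.exp_pos _).le h1 _
  rw [hs, Real.exp_neg, Real.exp_log (by linarith)] at hlt
  simp only [Finset.sum_const, Finset.card_univ, Fintype.card_fin, nsmul_eq_mul] at hlt
  rw [mul_inv_cancel₀ (by linarith)] at hlt
  exact lt_irrefl _ hlt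

lemma sqrt_le_div (h : Admissible M α) : √(Real.log n) ≤ Real.log n / M ^ 2 := by
  have hM := h.one_le
  have h1 := h.two_le_log
  rw [le_div_iff₀ (by positivity)]
  calc √(Real.log n) * M ^ 2 ≤ √(Real.log n) * √(Real.log n) := by gcongr; exact h.sq_le
    _ = _ := Real.mul_self_sqrt (by linarith)

lemma sqrt_le_vertexWeight_mul (h : Admissible M α) (hp : IsCritical α p₀) (v : Fin n) :
    √(Real.log n) / 2 ≤ vertexWeight α v * p₀ := by
  have hM := h.one_le
  calc √(Real.log n) / 2 ≤ Real.log n / M ^ 2 / 2 := by gcongr; exact h.sqrt_le_div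
    _ ≤ 2 * (((n : ℝ) - 1) * M * p₀) / M ^ 2 / 2 := by gcongr; exact h.critical_lower hp
    _ = ((n : ℝ) - 1) / M * p₀ := by field_simp
    _ ≤ _ := mul_le_mul_of_nonneg_right (h.le_vertexWeight v) hp.1

lemma mul_critical_le (h : Admissible M α) (hp : IsCritical α p₀) :
    M * p₀ ≤ 2 * √(Real.log n) * (Real.log n / n) := by
  have hM := h.one_le
  have hn3 := h.cast_ge
  have h1 := h.two_le_log
  have h2 : n * p₀ ≤ 2 * (M * Real.log n) := by
    have := h.critical_upper hp
    nlinarith [hp.1]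
  calc M * p₀ = M * (n * p₀) / n := by field_simp
    _ ≤ M * (2 * (M * Real.log n)) / n := by gcongr
    _ = 2 * M ^ 2 * (Real.log n / n) := by ring
    _ ≤ _ := by gcongr; exact h.sq_le

lemma exp_neg_le_xi (h : Admissible M α) (hp : IsCritical α p₀) (v : Fin n) :
    Real.exp (-(vertexWeight α v * p₀)) ≤ Real.exp 2 * xi α p₀ v := by
  have hN := h.choose_pos
  have hy1 := h.vertexWeight_mul_div_le hp v
  have h2 : 2 * ((vertexWeight α v * p₀) ^ 2 / n.choose 2) ≤ 2 := by
    have : (vertexWeight α v * p₀) ^ 2 / n.choose 2 ≤ 1 := by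
      rw [div_le_one hN]; exact h.sq_vertexWeight_mul_le hp v
    linarith
  set x := vertexWeight α v * p₀ with hx
  have h1 : Real.exp (-(x / n.choose 2) - 2 * (x / n.choose 2) ^ 2) ≤ 1 - x / n.choose 2 := by
    rw [← Real.le_log_iff_exp_le (by linarith)]
    exact neg_sub_le_log hy1
  calc Real.exp (-x) ≤ Real.exp (2 + (-x - 2 * (x ^ 2 / n.choose 2))) := by
        rw [Real.exp_le_exp]; linarith
    _ = Real.exp 2 * Real.exp (-(x / n.choose 2) - 2 * (x / n.choose 2) ^ 2) ^ n.choose 2 := by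
        rw [Real.exp_add, ← Real.exp_nat_mul]; congr 2; field_simp
    _ ≤ _ := by
        gcongr
        exact pow_le_pow_left₀ (Real.exp_pos _).le h1 _

end Admissible

end

/-! ### Below the critical value: the second moment method -/

section

variable {n : ℕ} {α : Edge n → ℝ} {M : ℝ}

/-- The second moment inequality for the number of isolated vertices. -/
lemma prob_no_isolated_le (hn : 2 ≤ n) (hα : ∀ e, 0 < α e) {p c : ℝ} {f : Fin n → ℝ}
    (hf0 : 0 < ∑ v, f v) (hc : 1 ≤ c) (hf : ∀ v, prob α p (fun A => star v ⊆ A) = f v)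
    (hpair : ∀ v w, v ≠ w → prob α p (fun A => star v ∪ star w ⊆ A) ≤ c * (f v * f w)) :
    prob α p (fun A => ∀ v, ¬ star v ⊆ A) ≤ (∑ v, f v)⁻¹ + (c - 1) := by
  classical
  set E := ∑ v, f v with hE
  have hfnn : ∀ v, 0 ≤ f v := fun v => by rw [← hf]; exact prob_nonneg _
  set X : Finset (Edge n) → ℝ := fun A => ∑ v, if star v ⊆ A then 1 else 0 with hX
  have hEX : expect α p X = E := by
    simp only [hX, expect_sum, hE, ← hf]
    exact Finset.sum_congr rfl fun v _ => by
      rw [prob_eq_expect hn hα]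
      congr 1; ext A; congr
  have hXX : expect α p (fun A => X A * X A) ≤ E + c * (E * E) := by
    have h1 : (fun A => X A * X A) = fun A => ∑ v, ∑ w,
        if star v ∪ star w ⊆ A then (1 : ℝ) else 0 := by
      ext A
      simp only [hX, Finset.sum_mul_sum]
      refine Finset.sum_congr rfl fun v _ => Finset.sum_congr rfl fun w _ => ?_
      rw [ite_zero_mul_ite_zero, mul_one]
      exact if_congr Finset.union_subset_iff.symm rfl rfl
    have h2 : E + c * (E * E) = ∑ v, ∑ w, ((if v = w then f v else 0) + c * (f v * f w)) := by
      simp only [Finset.sum_add_distrib, Finset.sum_ite_eq, Finset.mem_univ, if_true,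
        ← Finset.mul_sum, ← Finset.sum_mul, hE]
    rw [h1, h2]
    simp only [expect_sum]
    refine Finset.sum_le_sum fun v _ => Finset.sum_le_sum fun w _ => ?_
    have h3 : expect α p (fun A => if star v ∪ star w ⊆ A then (1 : ℝ) else 0) =
        prob α p (fun A => star v ∪ star w ⊆ A) := by
      rw [prob_eq_expect hn hα]
      congr 1; ext A; congr
    rw [h3]
    by_cases hvw : v = w
    · subst hvw
      have := mul_nonneg (zero_le_one.trans hc) (mul_nonneg (hfnn v) (hfnn v))
      rw [if_pos rfl, Finset.union_idempotent, hf]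
      linarith
    · rw [if_neg hvw, zero_add]
      exact hpair v w hvw
  have hmain : E * E * prob α p (fun A => ∀ v, ¬ star v ⊆ A) ≤ E + (c - 1) * (E * E) := by
    have h1 : E * E * prob α p (fun A => ∀ v, ¬ star v ⊆ A) ≤
        expect α p (fun A => X A * X A + (-(2 * E) * X A + E * E)) := by
      rw [prob_eq_expect hn hα, ← expect_const_mul]
      refine expect_mono fun A => ?_
      split_ifs with hA
      · have : X A = 0 := Finset.sum_eq_zero fun v _ => if_neg (hA v)
        rw [this]; simp
      · nlinarith [sq_nonneg (X A - E)]
    rw [expect_add, expect_add, expect_const_mul, expect_const hn hα, hEX] at h1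
    linarith
  have : E⁻¹ + (c - 1) = (E + (c - 1) * (E * E)) / (E * E) := by field_simp
  rw [this, le_div_iff₀ (by positivity)]
  linarith

lemma xi_eq_prob (hn : 2 ≤ n) (hα : ∀ e, 0 < α e) {p : ℝ} (hp : 0 ≤ p) {v : Fin n}
    (hv : vertexWeight α v * p ≤ n.choose 2) : prob α p (fun A => star v ⊆ A) = xi α p v := by
  rw [prob_superset hn hα hp, ← vertexWeight_eq, max_eq_right, xi]
  have := (div_le_one (choose_two_pos hn)).2 hv
  linarith

/-- Two vertices are isolated nearly independently. -/
lemma prob_star_union_le (hn : 2 ≤ n) (hα : ∀ e, 0 < α e) {p b : ℝ} (hp : 0 ≤ p) (hb : 0 ≤ b)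
    (hαb : ∀ e, α e ≤ b) {v w : Fin n} (hvw : v ≠ w)
    (hv : vertexWeight α v * p / n.choose 2 ≤ 1 / 2)
    (hw : vertexWeight α w * p / n.choose 2 ≤ 1 / 2) :
    prob α p (fun A => star v ∪ star w ⊆ A) ≤
      Real.exp (4 * (b * p)) * (xi α p v * xi α p w) := by
  have hN := choose_two_pos hn
  rw [prob_superset hn hα hp]
  have h1 := div_le_div_of_nonneg_right
    (mul_le_mul_of_nonneg_right (le_sum_star_union hb hαb hvw) hp) hN.le
  have hvw0 : ∀ u, 0 ≤ vertexWeight α u * p / n.choose 2 := fun u =>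
    div_nonneg (mul_nonneg (Finset.sum_nonneg fun e _ => (hα e).le) hp) hN.le
  have hv0 := hvw0 v
  have hw0 := hvw0 w
  set y := vertexWeight α v * p / n.choose 2 with hy
  set z := vertexWeight α w * p / n.choose 2 with hz
  set t := b * p / n.choose 2 with ht
  have ht0 : 0 ≤ t := by positivity
  have h2 : (vertexWeight α v + vertexWeight α w - b) * p / n.choose 2 = y + z - t := by
    rw [hy, hz, ht]; ring
  rw [h2] at h1
  have h3 : 1 + 4 * t ≤ Real.exp (4 * t) := by linarith [Real.add_one_le_exp (4 * t)]
  have hyz : 1 / 4 ≤ (1 - y) * (1 - z) := by nlinarith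
  have hyz0 : 0 ≤ (1 - y) * (1 - z) := by linarith
  calc _ ≤ (Real.exp (4 * t) * ((1 - y) * (1 - z))) ^ n.choose 2 := by
        refine pow_le_pow_left₀ (le_max_left _ _) (max_le (by positivity) ?_) _
        have h4 := mul_le_mul_of_nonneg_right h3 hyz0
        nlinarith [mul_nonneg hv0 hw0, mul_le_mul_of_nonneg_left hyz ht0]
    _ = _ := by
        rw [mul_pow, mul_pow, ← Real.exp_nat_mul, xi, xi]
        congr 2
        rw [ht]; field_simp

variable {p₀ : ℝ}

lemma one_sub_mul_exp_le {ε y : ℝ} (hε0 : 0 ≤ ε) (hε1 : ε ≤ 1) (hy1 : y ≤ 1 / 2) :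
    (1 - y) * Real.exp (ε * y) ≤ 1 - (1 - ε) * y := by
  have h0 : 0 < 1 - ε * y := by nlinarith
  have h1 : Real.exp (ε * y) ≤ (1 - ε * y)⁻¹ := by
    rw [← neg_neg (ε * y), Real.exp_neg, inv_le_inv₀ (Real.exp_pos _) (by linarith)]
    linarith [Real.add_one_le_exp (-(ε * y))]
  calc (1 - y) * Real.exp (ε * y) ≤ (1 - y) * (1 - ε * y)⁻¹ := by gcongr; linarith
    _ ≤ 1 - (1 - ε) * y := by
      rw [← div_eq_mul_inv, div_le_iff₀ h0]
      nlinarith [mul_nonneg (mul_nonneg hε0 (sub_nonneg.2 hε1)) (sq_nonneg y)]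

/-- Just below the critical value the expected number of isolated vertices is large. -/
lemma Admissible.exp_le_sum_xi (h : Admissible M α) (hp : IsCritical α p₀) {ε : ℝ} (hε0 : 0 ≤ ε)
    (hε1 : ε ≤ 1) :
    Real.exp (ε * (√(Real.log n) / 2)) ≤ ∑ v, xi α ((1 - ε) * p₀) v := by
  have hN := h.choose_pos
  calc Real.exp (ε * (√(Real.log n) / 2)) = ∑ v, Real.exp (ε * (√(Real.log n) / 2)) * xi α p₀ v := by
        rw [← Finset.mul_sum, hp.2.2, mul_one]
    _ ≤ ∑ v, xi α ((1 - ε) * p₀) v := by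
        refine Finset.sum_le_sum fun v _ => ?_
        have hy1 := h.vertexWeight_mul_div_le hp v
        have hx := h.sqrt_le_vertexWeight_mul hp v
        have hkey := one_sub_mul_exp_le hε0 hε1 hy1
        set y := vertexWeight α v * p₀ / n.choose 2 with hy
        calc Real.exp (ε * (√(Real.log n) / 2)) * xi α p₀ v
            ≤ Real.exp (ε * (vertexWeight α v * p₀)) * (1 - y) ^ n.choose 2 := by
              rw [xi, ← hy]
              have : 0 ≤ (1 - y) ^ n.choose 2 := pow_nonneg (by linarith) _
              gcongr
          _ = ((1 - y) * Real.exp (ε * y)) ^ n.choose 2 := by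
              rw [mul_pow, ← Real.exp_nat_mul, mul_comm, hy]; congr 2; field_simp
          _ ≤ (1 - (1 - ε) * y) ^ n.choose 2 :=
              pow_le_pow_left₀ (mul_nonneg (by linarith) (Real.exp_pos _).le) hkey _
          _ = _ := by rw [xi, hy]; congr 2; ring

lemma Admissible.probConnected_below_le (h : Admissible M α) (hp : IsCritical α p₀) {ε : ℝ}
    (hε0 : 0 ≤ ε) (hε1 : ε ≤ 1) :
    probConnected n α ((1 - ε) * p₀) ≤ (Real.exp (ε * (√(Real.log n) / 2)))⁻¹ +
      (Real.exp (8 * (√(Real.log n) * (Real.log n / n))) - 1) := by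
  have hn : 2 ≤ n := by have := h.three_le; omega
  have hN := h.choose_pos
  have hM := h.one_le
  have hL := h.two_le_log
  have hn3 := h.cast_ge
  have hq0 : 0 ≤ (1 - ε) * p₀ := mul_nonneg (by linarith) hp.1
  have hq1 : (1 - ε) * p₀ ≤ p₀ := by nlinarith [hp.1]
  have hw : ∀ v, vertexWeight α v * ((1 - ε) * p₀) ≤ vertexWeight α v * p₀ := fun v =>
    mul_le_mul_of_nonneg_left hq1 (h.vertexWeight_pos v).le
  have hhalf : ∀ v, vertexWeight α v * ((1 - ε) * p₀) / n.choose 2 ≤ 1 / 2 := fun v =>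
    (div_le_div_of_nonneg_right (hw v) hN.le).trans (h.vertexWeight_mul_div_le hp v)
  have hE := h.exp_le_sum_xi hp hε0 hε1
  have hEpos := (Real.exp_pos _).trans_le hE
  rw [probConnected_eq]
  calc _ ≤ prob α ((1 - ε) * p₀) (fun A => ∀ v, ¬ star v ⊆ A) :=
        prob_mono hn h.pos fun A hA v hv => not_connected_of_star_subset hn hv hA
    _ ≤ (∑ v, xi α ((1 - ε) * p₀) v)⁻¹ + (Real.exp (8 * (√(Real.log n) * (Real.log n / n))) - 1) := by
        refine prob_no_isolated_le hn h.pos hEpos (Real.one_le_exp (by positivity))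
          (fun v => xi_eq_prob hn h.pos hq0 ((hw v).trans (hp.2.1 v))) fun v w hvw => ?_
        refine (prob_star_union_le hn h.pos hq0 (by linarith) h.upper hvw (hhalf v)
          (hhalf w)).trans ?_
        have hxi : ∀ v, 0 ≤ xi α ((1 - ε) * p₀) v := fun v =>
          pow_nonneg (by linarith [hhalf v]) _
        have hMp : M * ((1 - ε) * p₀) ≤ 2 * √(Real.log n) * (Real.log n / n) :=
          (mul_le_mul_of_nonneg_left hq1 (by linarith)).trans (h.mul_critical_le hp)
        refine mul_le_mul_of_nonneg_right (Real.exp_le_exp.2 ?_) (mul_nonneg (hxi v) (hxi w))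
        linarith
    _ ≤ _ := by gcongr

end

lemma tendsto_sqrt_log : Tendsto (fun n : ℕ => √(Real.log n)) atTop atTop :=
  Real.tendsto_sqrt_atTop.comp tendsto_log_nat

lemma tendsto_sqrt_log_mul : Tendsto (fun n : ℕ => √(Real.log n) * (Real.log n / n)) atTop (𝓝 0) := by
  refine squeeze_zero' ?_ ?_ (tendsto_log_pow_div 2)
  · filter_upwards [tendsto_log_nat.eventually_ge_atTop 1] with n hn
    positivity
  · filter_upwards [tendsto_log_nat.eventually_ge_atTop 1] with n hn
    have : √(Real.log n) ≤ Real.log n := by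
      rw [Real.sqrt_le_left (by linarith)]; nlinarith
    rw [sq, mul_div_assoc]
    gcongr

section

variable {α : (n : ℕ) → Edge n → ℝ} {M p₀ p : ℕ → ℝ} {ε : ℝ}

lemma tendsto_probConnected_below (hM : ∀ᶠ n in atTop, Admissible (M n) (α n))
    (hp₀ : ∀ᶠ n in atTop, IsCritical (α n) (p₀ n)) (hε : 0 < ε)
    (hp : ∀ᶠ n in atTop, p n ≤ (1 - ε) * p₀ n) :
    Tendsto (fun n => probConnected n (α n) (p n)) atTop (𝓝 0) := by
  -- for `ε > 1` the bound `p n ≤ 0` is still covered, by monotonicity in `p`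
  set δ := min ε 1
  have hδ0 : 0 < δ := lt_min hε one_pos
  have hlim : Tendsto (fun n : ℕ => (Real.exp (δ * (√(Real.log n) / 2)))⁻¹ +
      (Real.exp (8 * (√(Real.log n) * (Real.log n / n))) - 1)) atTop (𝓝 0) := by
    have h1 : Tendsto (fun n : ℕ => δ * (√(Real.log n) / 2)) atTop atTop :=
      (tendsto_sqrt_log.atTop_div_const two_pos).const_mul_atTop hδ0
    have h2 := tendsto_inv_atTop_zero.comp (Real.tendsto_exp_atTop.comp h1)
    have h3 := ((Real.continuous_exp.tendsto _).comp (tendsto_sqrt_log_mul.const_mul 8)).sub_const 1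
    have h4 := h2.add h3
    simpa [Function.comp_def] using h4
  refine squeeze_zero' (Eventually.of_forall fun n => probConnected_nonneg) ?_ hlim
  filter_upwards [hM, hp₀, hp] with n h1 h2 h3
  refine (probConnected_mono (by have := h1.three_le; omega) h1.pos (h3.trans ?_)).trans
    (h1.probConnected_below_le h2 hδ0.le (min_le_right _ _))
  have : δ ≤ ε := min_le_left _ _
  nlinarith [h2.1]

end

/-! ### Above the critical value: the union bound -/

section

variable {n : ℕ} {α : Edge n → ℝ} {M p₀ ε : ℝ}

lemma Admissible.sum_exp_above_le (h : Admissible M α) (hp : IsCritical α p₀) (hε : 0 ≤ ε) :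
    ∑ v, Real.exp (-(vertexWeight α v * ((1 + ε) * p₀))) ≤
      Real.exp (2 - ε * (√(Real.log n) / 2)) := by
  calc _ ≤ ∑ v, Real.exp (2 - ε * (√(Real.log n) / 2)) * xi α p₀ v := by
        refine Finset.sum_le_sum fun v _ => ?_
        have h1 := h.exp_neg_le_xi hp v
        have h2 := h.sqrt_le_vertexWeight_mul hp v
        calc _ = Real.exp (-(ε * (vertexWeight α v * p₀))) *
              Real.exp (-(vertexWeight α v * p₀)) := by rw [← Real.exp_add]; congr 1; ring
          _ ≤ Real.exp (-(ε * (√(Real.log n) / 2))) * (Real.exp 2 * xi α p₀ v) := by gcongr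
          _ = _ := by rw [sub_eq_add_neg, Real.exp_add]; ring
    _ = _ := by rw [← Finset.mul_sum, hp.2.2, mul_one]

/-- The cut of a vertex set of at most half the size is heavy. -/
lemma Admissible.sqrt_mul_card_le (h : Admissible M α) (hp : IsCritical α p₀) (hε : 0 ≤ ε)
    {S : Finset (Fin n)} (hS : 2 * S.card ≤ n) :
    1 / 4 * √(Real.log n) * S.card ≤ (∑ e ∈ cut S, α e) * ((1 + ε) * p₀) := by
  have hM := h.one_le
  have hn3 := h.cast_ge
  have hS' : 2 * (S.card : ℝ) ≤ n := by exact_mod_cast hS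
  have h0 := hp.1
  have hlow : Real.log n ≤ 2 * (n * M * p₀) := by
    have h1 := h.critical_lower hp
    have h2 : 0 ≤ M * p₀ := mul_nonneg (by linarith) h0
    nlinarith
  calc 1 / 4 * √(Real.log n) * S.card ≤ 1 / 4 * (Real.log n / M ^ 2) * S.card := by
        gcongr; exact h.sqrt_le_div
    _ ≤ 1 / 4 * (2 * (n * M * p₀) / M ^ 2) * S.card := by gcongr
    _ = S.card * (n / 2) * (1 / M) * p₀ := by field_simp; ring
    _ ≤ S.card * (n - S.card) * (1 / M) * p₀ := by gcongr; linarith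
    _ ≤ (∑ e ∈ cut S, α e) * p₀ := by gcongr; exact le_sum_cut h.lower S
    _ ≤ _ := by
        have : 0 ≤ ∑ e ∈ cut S, α e := Finset.sum_nonneg fun e _ => (h.pos e).le
        gcongr
        nlinarith

lemma Admissible.sum_small_cut_above_le (h : Admissible M α) (hp : IsCritical α p₀) (hε : 0 < ε) :
    ∑ S ∈ Finset.univ.filter (fun S : Finset (Fin n) =>
        S.Nonempty ∧ (S.card : ℝ) ≤ ε / (8 * (1 + ε)) * n / Real.log n),
      prob α ((1 + ε) * p₀) (fun A => cut S ⊆ A) ≤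
        Real.exp (Real.exp (2 - ε / 4 * √(Real.log n))) - 1 := by
  have hM := h.one_le
  have hn3 := h.cast_ge
  have hL := h.two_le_log
  have hn : 2 ≤ n := by have := h.three_le; omega
  refine (sum_small_cut_le hn h.pos (mul_nonneg (by linarith) hp.1) (by linarith : 0 ≤ M)
    h.upper).trans ?_
  gcongr
  -- the factor per vertex is at most the square root of the gain `exp (ε √(log n) / 2)` from
  -- passing from `p₀` to `(1 + ε) p₀`
  have hexp : ε / (8 * (1 + ε)) * n / Real.log n * M * ((1 + ε) * p₀) ≤ ε / 4 * √(Real.log n) := by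
    calc _ = ε / 8 * n / Real.log n * (M * p₀) := by field_simp
      _ ≤ ε / 8 * n / Real.log n * (2 * √(Real.log n) * (Real.log n / n)) := by
          have h1 := h.mul_critical_le hp
          have h2 : 0 ≤ ε / 8 * n / Real.log n := by positivity
          exact mul_le_mul_of_nonneg_left h1 h2
      _ = _ := by field_simp; ring
  calc _ ≤ Real.exp (ε / 4 * √(Real.log n)) * Real.exp (2 - ε * (√(Real.log n) / 2)) := by
        gcongr; exact h.sum_exp_above_le hp hε.le
    _ = _ := by rw [← Real.exp_add]; congr 1; ring

end

section

variable {α : (n : ℕ) → Edge n → ℝ} {M p₀ p : ℕ → ℝ} {ε : ℝ}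

lemma tendsto_probConnected_above (hα : ∀ n e, 0 < α n e)
    (hM : ∀ᶠ n in atTop, Admissible (M n) (α n))
    (hp₀ : ∀ᶠ n in atTop, IsCritical (α n) (p₀ n)) (hε : 0 < ε)
    (hp : ∀ᶠ n in atTop, (1 + ε) * p₀ n ≤ p n) :
    Tendsto (fun n => probConnected n (α n) (p n)) atTop (𝓝 1) := by
  have hlarge := tendsto_sum_large_cut (α := α) (p := fun n => (1 + ε) * p₀ n) (c := 1 / 4)
    (κ := ε / (8 * (1 + ε))) hα (hp₀.mono fun n h => mul_nonneg (by linarith) h.1)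
    (by positivity) (by norm_num) (by
      filter_upwards [hM, hp₀] with n h1 h2 S hS
      exact h1.sqrt_mul_card_le h2 hε.le hS)
  have hsmall : Tendsto (fun n : ℕ => Real.exp (Real.exp (2 - ε / 4 * √(Real.log n))) - 1) atTop
      (𝓝 0) := by
    have h1 : Tendsto (fun n : ℕ => 2 - ε / 4 * √(Real.log n)) atTop atBot :=
      tendsto_const_nhds.add_atBot
        (tendsto_neg_atTop_atBot.comp (tendsto_sqrt_log.const_mul_atTop (by positivity : 0 < ε / 4)))
    have h2 := ((Real.continuous_exp.tendsto _).comp (Real.tendsto_exp_atBot.comp h1)).sub_const 1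
    simpa [Function.comp_def] using h2
  have hlim := (hsmall.add hlarge).const_sub 1
  rw [add_zero, sub_zero] at hlim
  refine tendsto_of_tendsto_of_tendsto_of_le_of_le' hlim tendsto_const_nhds ?_ ?_
  · filter_upwards [hM, hp₀, hp] with n h1 h2 h3
    have hn : 2 ≤ n := by have := h1.three_le; omega
    have h4 := prob_not_connected_le (p := (1 + ε) * p₀ n) hn (hα n)
      (ε / (8 * (1 + ε)) * n / Real.log n)
    have h5 := h1.sum_small_cut_above_le h2 hε
    have h6 := probConnected_mono hn (hα n) h3
    linarith
  · filter_upwards [eventually_ge_atTop 2] with n hn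
    exact probConnected_le_one hn (hα n)

end

end SimplexGraph

theorem theorem4 :
    -- part (a): all coefficients equal to one
    (∀ c : ℕ → ℝ,
      (Tendsto c atTop atBot →
        Tendsto (fun n : ℕ => SimplexGraph.probConnected n (fun _ => 1)
          ((Real.log n + c n) / n)) atTop (𝓝 0)) ∧
      (∀ c' : ℝ, Tendsto c atTop (𝓝 c') →
        Tendsto (fun n : ℕ => SimplexGraph.probConnected n (fun _ => 1)
          ((Real.log n + c n) / n)) atTop (𝓝 (Real.exp (-Real.exp (-c'))))) ∧
      (Tendsto c atTop atTop →
        Tendsto (fun n : ℕ => SimplexGraph.probConnected n (fun _ => 1)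
          ((Real.log n + c n) / n)) atTop (𝓝 1))) ∧
    -- part (b): coefficients that are M-bounded
    (∀ (α : (n : ℕ) → SimplexGraph.Edge n → ℝ) (M : ℕ → ℝ),
      (∀ n e, 0 < α n e) →
      (∀ᶠ n : ℕ in atTop, SimplexGraph.MBounded (M n) (α n) ∧
        M n ≤ Real.log n ^ ((1 : ℝ) / 4)) →
      (∀ᶠ n : ℕ in atTop, ∃! q : ℝ, SimplexGraph.IsCritical (α n) q) ∧
      ∀ p₀ : ℕ → ℝ, (∀ᶠ n : ℕ in atTop, SimplexGraph.IsCritical (α n) (p₀ n)) →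
        ∀ ε : ℝ, 0 < ε → ∀ p : ℕ → ℝ,
          ((∀ᶠ n : ℕ in atTop, p n ≤ (1 - ε) * p₀ n) →
            Tendsto (fun n : ℕ => SimplexGraph.probConnected n (α n) (p n)) atTop (𝓝 0)) ∧
          ((∀ᶠ n : ℕ in atTop, (1 + ε) * p₀ n ≤ p n) →
            Tendsto (fun n : ℕ => SimplexGraph.probConnected n (α n) (p n)) atTop (𝓝 1))) := by
  refine ⟨fun c => ⟨SimplexGraph.tendsto_probConnected_one_atBot,
    fun c' => SimplexGraph.tendsto_probConnected_one_nhds,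
    SimplexGraph.tendsto_probConnected_one_atTop⟩, fun α M hα hM => ?_⟩
  have hadm := SimplexGraph.eventually_admissible hα hM
  refine ⟨hadm.mono fun n h => SimplexGraph.existsUnique_isCritical h,
    fun p₀ hp₀ ε hε p => ⟨SimplexGraph.tendsto_probConnected_below hadm hp₀ hε,
      SimplexGraph.tendsto_probConnected_above hα hadm hp₀ hε⟩⟩
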